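/- **Theorem 1 (Convergence of DP-Clipped-SGD for convex objectives).** Let $f:\mathbb{R}^d\to\mathbb{R}$, let $x^\star\in\arg\min_{x\in\mathbb{R}^d} f(x)$, let $x^0\in\mathbb{R}^d$, let $R\ge\|x^0-x^\star\|$, and let $Q=B_{2R}(x^\star)$ be the closed Euclidean ball of radius $2R$ around $x^\star$. Assume, for constants $L>0$, $\sigma>0$ and $\alpha\in(1,2]$: - (smoothness) $f$ is differentiable at the points of $Q$ and $\|\nabla f(x)-\nabla f(y)\|\le L\|x-y\|$ for all $x,y\in Q$; - (convexity) $f(y)\ge f(x)+\langle\nabla f(x),y-x\rangle$ for all $x,y\in Q$; - (stochastic oracle) for $\xi\sim\mathcal{D}$ and all $x\in Q$, the stochastic gradient $\nabla f_\xi(x)$ satisfies $\mathbb{E}[\nabla f_\xi(x)]=\nabla f(x)$ and $\mathbb{E}\|\nabla f_\xi(x)-\nabla f(x)\|^\alpha\le\sigma^\alpha$. Let $K\ge 0$ be an integer, $\beta\in(0,1]$, $\lambda>0$, $\sigma_\omega\ge 0$, $\gamma>0$. DP-Clipped-SGD is the iteration $$x^{k+1}=x^k-\gamma\bigl(\mathrm{clip}(\nabla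 f_{\xi^k}(x^k),\lambda)+\omega_k\bigr),\qquad \mathrm{clip}(x,\lambda)=\min\Bigl\{1,\frac{\lambda}{\|x\|}\Bigr\}x,$$ where $\xi^k\sim\mathcal{D}$ and $\omega_k\sim\mathcal{N}(0,\sigma_\omega^2 I_d)$, $k=0,1,\dots$, are all mutually independent. Put $\zeta_\lambda=\max\{0,2LR-\frac{\lambda}{2}\}$ and $\phi=\sqrt{3\ln\frac{4(K+1)}{\beta}}$, and assume $\gamma\le\min\{\frac{1}{8L},\gamma_1,\dots,\gamma_6\}$, where (with $R/0=+\infty$ in $\gamma_3$ and $\gamma_6$) $$\gamma_1=\frac{R}{42(2^{2\alpha-1}+1)^{1/2}\sigma^{\alpha/2}\lambda^{1-\alpha/2}\sqrt{6(K+1)\ln\frac{8(K+1)}{\beta}\cdot\left(1+\frac{\zeta_\lambda^\alpha}{\sigma^\alpha}\right)}},$$ $$\gamma_2=\frac{R\lambda^{\alpha-1}}{28(K+1)2^{2\alpha-1}\sigma^\alpha\left(1+\frac{\zeta_\lambda^\alpha}{\sigma^\alpha}\right)\left(\frac{\zeta_\lambda}{\lambda}+\frac12+\frac{\lambda^{\alpha-1}\zeta_\lambda}{2^{2\alpha-1}(\sigma^\alpha+\zeta_\lambda^\alpha)}+\left(1+\frac{\zeta_\lambda^\alpha}{\sigma^\alpha}\right)^{-1/\alpha}\right)},$$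 $$\gamma_3=\frac{R}{56\sigma_\omega\sqrt{d(K+1)}\,(\sqrt2+\sqrt2\phi)},\qquad \gamma_4=\frac{(2-\sqrt2)R}{\lambda+\sigma_\omega\left(\sqrt d+\sqrt{2\ln\frac{K+1}{\beta}}\right)},\qquad \gamma_5=\frac{R}{56\lambda\ln\frac{8(K+1)}{\beta}},$$ $$\gamma_6=\frac{R}{2\sigma_\omega\sqrt{7\left[(K+1)d+2\sqrt{(K+1)d\ln\frac{4(K+1)}{\beta}}+2\ln\frac{4(K+1)}{\beta}\right]}}.$$ Then, with probability at least $1-\beta$, simultaneously $$\min_{0\le k\le K}f(x^k)-f(x^\star)\le\frac{4R^2}{\gamma(K+1)}+\frac{64LR^4}{\lambda^2\gamma^2(K+1)^2}\qquad\text{and}\qquad x^0,\dots,x^K\in B_{\sqrt2R}(x^\star).$$ -/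

import Mathlib

open MeasureTheory ProbabilityTheory

noncomputable section

namespace DPClippedSGD

/-- The Euclidean space of dimension `d`. -/
abbrev E (d : ℕ) : Type := EuclideanSpace ℝ (Fin d)

/-- The clipping operator `clip (x, lam) = min {1, lam / ‖x‖} x` (it sends `0` to `0`). -/
def clip {d : ℕ} (x : E d) (lam : ℝ) : E d := min 1 (lam / ‖x‖) • x

/-- The Gaussian distribution with mean `0` and covariance matrix `sw ^ 2` times the identity. -/
def gaussianNoise (d : ℕ) (sw : ℝ) : Measure (E d) :=
  multivariateGaussian 0 (sw ^ 2 • (1 : Matrix (Fin d) (Fin d) ℝ))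

/-- `f` is differentiable at every point of `Q` and its gradient is `L`-Lipschitz on `Q`. -/
def SmoothOnSet {d : ℕ} (f : E d → ℝ) (L : ℝ) (Q : Set (E d)) : Prop :=
  (∀ x ∈ Q, DifferentiableAt ℝ f x) ∧
    ∀ x ∈ Q, ∀ y ∈ Q, ‖gradient f x - gradient f y‖ ≤ L * ‖x - y‖

/-- The first-order convexity inequality on `Q`. -/
def GradConvexOn {d : ℕ} (f : E d → ℝ) (Q : Set (E d)) : Prop :=
  ∀ x ∈ Q, ∀ y ∈ Q, f x + inner ℝ (gradient f x) (y - x) ≤ f y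

/-- The stochastic gradients `G x ξ`, with `ξ` distributed as `D`, are unbiased estimates of the
gradient of `f` on `Q`, with central moment of order `α` at most `σ ^ α`. -/
def OracleOn {d : ℕ} {S : Type*} [MeasurableSpace S] (f : E d → ℝ) (G : E d → S → E d)
    (D : Measure S) (σ α : ℝ) (Q : Set (E d)) : Prop :=
  ∀ x ∈ Q,
    (Integrable (G x) D ∧ ∫ s, G x s ∂D = gradient f x) ∧
    (Integrable (fun s => ‖G x s - gradient f x‖ ^ α) D ∧
      ∫ s, ‖G x s - gradient f x‖ ^ α ∂D ≤ σ ^ α)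

/-- The iterates of DP-Clipped-SGD from `x0` with step size `γ` and clipping level `lam`, driven by
the samples `ξ k` and the privacy noise `w k`:
`x (k + 1) = x k - γ (clip (G (x k) (ξ k), lam) + w k)`. -/
def iterate {d : ℕ} {S : Type*} (G : E d → S → E d) (x0 : E d) (γ lam : ℝ)
    (ξ : ℕ → S) (w : ℕ → E d) : ℕ → E d
  | 0 => x0
  | k + 1 =>
      iterate G x0 γ lam ξ w k - γ • (clip (G (iterate G x0 γ lam ξ w k) (ξ k)) lam + w k)

/-- `ζ = max {0, 2 L R - lam / 2}`. -/
def zeta (L R lam : ℝ) : ℝ := max 0 (2 * L * R - lam / 2)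

def gamma1 (L R lam σ α β : ℝ) (K : ℕ) : ℝ :=
  R / (42 * (2 ^ (2 * α - 1) + 1) ^ (1 / 2 : ℝ) * σ ^ (α / 2) * lam ^ (1 - α / 2) *
    √(6 * (K + 1) * Real.log (8 * (K + 1) / β) * (1 + zeta L R lam ^ α / σ ^ α)))

def gamma2 (L R lam σ α : ℝ) (K : ℕ) : ℝ :=
  R * lam ^ (α - 1) /
    (28 * (K + 1) * 2 ^ (2 * α - 1) * σ ^ α * (1 + zeta L R lam ^ α / σ ^ α) *
      (zeta L R lam / lam + 1 / 2
        + lam ^ (α - 1) * zeta L R lam / (2 ^ (2 * α - 1) * (σ ^ α + zeta L R lam ^ α))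
        + (1 + zeta L R lam ^ α / σ ^ α) ^ (-1 / α)))

def phi (β : ℝ) (K : ℕ) : ℝ := √(3 * Real.log (4 * (K + 1) / β))

/-- The denominator of the third bound `R / gamma3Den`; it vanishes iff `sw = 0` or `d = 0`. -/
def gamma3Den (d : ℕ) (sw β : ℝ) (K : ℕ) : ℝ :=
  56 * sw * √(d * (K + 1)) * (√2 + √2 * phi β K)

def gamma4 (d : ℕ) (R lam sw β : ℝ) (K : ℕ) : ℝ :=
  (2 - √2) * R / (lam + sw * (√d + √(2 * Real.log ((K + 1) / β))))

def gamma5 (R lam β : ℝ) (K : ℕ) : ℝ :=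
  R / (56 * lam * Real.log (8 * (K + 1) / β))

/-- The denominator of the sixth bound `R / gamma6Den`; it vanishes iff `sw = 0`. -/
def gamma6Den (d : ℕ) (sw β : ℝ) (K : ℕ) : ℝ :=
  2 * sw * √(7 * ((K + 1) * d + 2 * √((K + 1) * d * Real.log (4 * (K + 1) / β))
    + 2 * Real.log (4 * (K + 1) / β)))

/-- The step-size condition `γ ≤ min {1 / (8 L), γ₁, …, γ₆}`. The bounds `γ₃ = R / gamma3Den` and
`γ₆ = R / gamma6Den` are written without division, so that they are no restriction (rather than a
division by zero) when there is no privacy noise. -/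
structure StepSizeCond (d : ℕ) (γ L R lam σ α sw β : ℝ) (K : ℕ) : Prop where
  le_zero : γ ≤ 1 / (8 * L)
  le_one : γ ≤ gamma1 L R lam σ α β K
  le_two : γ ≤ gamma2 L R lam σ α K
  le_three : γ * gamma3Den d sw β K ≤ R
  le_four : γ ≤ gamma4 d R lam sw β K
  le_five : γ ≤ gamma5 R lam β K
  le_six : γ * gamma6Den d sw β K ≤ R

end DPClippedSGD

end

/-! Expand the squared distance to the minimizer, with the clipped true gradient `clip (gradient f
x) (lam / 2)` as reference direction. Inside the ball of radius `√2 * R`, convexity and smoothness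
give a decrease by `γ` times the gap damped by the clipping factor, plus an increment from the
stochastic gradient and one from the Gaussian noise (`sq_norm_step_le`). If the increments sum to at
most `R ^ 2`, the squared distance never exceeds `2 * R ^ 2`, so the iterates stay in the ball.
Averaging then yields an iterate with small damped gap, hence small gap (`sub_le_of_dampedGap_le`).

The sum is controlled by one Chernoff bound. Write `ℓ = log (8 (K + 1) / β)` and `s = 2 ℓ / R ^ 2`.
At every point of the ball the exponential moment of `s` times the increment is at most `exp (ℓ / (K
+ 1))` (`lintegral_exp_incr_le`): the clipping error is bounded, with mean and second moment
controlled by the `α`-th moment, and the Gaussian part is explicit. Multiplying over `K + 1` steps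
gives `exp ℓ`, while exceeding `R ^ 2` costs `exp (2 ℓ)`; the failure probability is thus at most
`exp (-ℓ) ≤ β`.

The one-step bound holds only in the ball, so the method is frozen on exit. This gives a uniform
bound for every state, which `lintegral_prod_chain_le` turns into a product bound. -/

namespace DPClippedSGD

open scoped ENNReal

/-! ### Recursions driven by independent innovations -/

section Chain

variable {Ω U V : Type*} [MeasurableSpace U] [MeasurableSpace V]

/-- A recursively defined process is a measurable function of the innovations used so far. -/
lemma exists_measurable_eq_comp_restrict {u : ℕ → Ω → U} {step : V → U → V}
    (hstep : Measurable (Function.uncurry step)) {Y : ℕ → Ω → V} {y0 : V}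
    (h0 : ∀ a, Y 0 a = y0) (hY : ∀ n a, Y (n + 1) a = step (Y n a) (u n a)) (n : ℕ) :
    ∃ Φ : (Finset.range n → U) → V, Measurable Φ ∧
      ∀ a, Y n a = Φ (fun i => u i a) := by
  induction n with
  | zero => exact ⟨fun _ => y0, measurable_const, h0⟩
  | succ n ih =>
    obtain ⟨Φ, hΦ, h⟩ := ih
    refine ⟨fun p => step (Φ fun i => p ⟨i, Finset.mem_range.2
      ((Finset.mem_range.1 i.2).trans n.lt_succ_self)⟩) (p ⟨n, Finset.self_mem_range_succ n⟩),
      ?_, fun a => by rw [hY, h]⟩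
    exact hstep.comp ((hΦ.comp (measurable_pi_lambda _ fun i => measurable_pi_apply _)).prodMk
      (measurable_pi_apply _))

variable [MeasurableSpace Ω]

lemma measurable_of_recursion {u : ℕ → Ω → U} (hu : ∀ k, Measurable (u k)) {step : V → U → V}
    (hstep : Measurable (Function.uncurry step)) {Y : ℕ → Ω → V} {y0 : V}
    (h0 : ∀ a, Y 0 a = y0) (hY : ∀ n a, Y (n + 1) a = step (Y n a) (u n a)) (n : ℕ) :
    Measurable (Y n) := by
  obtain ⟨Φ, hΦ, h⟩ := exists_measurable_eq_comp_restrict hstep h0 hY n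
  rw [funext h]
  exact hΦ.comp (measurable_pi_lambda _ fun i => hu i)

/-- The state of a recursively defined process is independent of the next innovation. -/
lemma indepFun_of_recursion {P : Measure Ω} [IsProbabilityMeasure P] {u : ℕ → Ω → U}
    (hu : ∀ k, Measurable (u k)) (hind : iIndepFun u P) {step : V → U → V}
    (hstep : Measurable (Function.uncurry step)) {Y : ℕ → Ω → V} {y0 : V}
    (h0 : ∀ a, Y 0 a = y0) (hY : ∀ n a, Y (n + 1) a = step (Y n a) (u n a)) (n : ℕ) :
    IndepFun (Y n) (u n) P := by
  obtain ⟨Φ, hΦ, h⟩ := exists_measurable_eq_comp_restrict hstep h0 hY n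
  have := (hind.indepFun_finset (Finset.range n) {n} (by simp) hu).comp hΦ
    (measurable_pi_apply (⟨n, Finset.mem_singleton_self n⟩ : ({n} : Finset ℕ)))
  rwa [funext h]

/-- Adjoining the running product to the state gives another recursive process, which is therefore
independent of the next innovation. Fubini then integrates out that innovation first, at a cost of
`C` uniformly in the state, with no need for conditional expectations. -/
lemma lintegral_prod_chain_le {P : Measure Ω} [IsProbabilityMeasure P] {μ : Measure U}
    [IsProbabilityMeasure μ] {u : ℕ → Ω → U}
    (hu : ∀ k, Measurable (u k)) (hind : iIndepFun u P) (hlaw : ∀ k, P.map (u k) = μ)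
    {step : V → U → V} (hstep : Measurable (Function.uncurry step)) {Y : ℕ → Ω → V} {y0 : V}
    (h0 : ∀ a, Y 0 a = y0) (hY : ∀ n a, Y (n + 1) a = step (Y n a) (u n a))
    {F : V → U → ℝ≥0∞} (hF : Measurable (Function.uncurry F)) {C : ℝ≥0∞}
    (hC : ∀ v, ∫⁻ z, F v z ∂μ ≤ C) (n : ℕ) :
    ∫⁻ a, ∏ j ∈ Finset.range n, F (Y j a) (u j a) ∂P ≤ C ^ n := by
  induction n with
  | zero => simp
  | succ n ih =>
    set W : ℕ → Ω → V × ℝ≥0∞ := fun n a => (Y n a, ∏ j ∈ Finset.range n, F (Y j a) (u j a))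
    have hst : Measurable (Function.uncurry fun (p : V × ℝ≥0∞) (z : U) =>
        (step p.1 z, p.2 * F p.1 z)) := by
      refine Measurable.prodMk ?_ (Measurable.mul (by fun_prop) ?_)
      · exact hstep.comp (f := fun q : (V × ℝ≥0∞) × U => (q.1.1, q.2)) (by fun_prop)
      · exact hF.comp (f := fun q : (V × ℝ≥0∞) × U => (q.1.1, q.2)) (by fun_prop)
    have hW0 : ∀ a, W 0 a = (y0, 1) := fun a => by simp [W, h0]
    have hW : ∀ n a, W (n + 1) a = (step (W n a).1 (u n a), (W n a).2 * F (W n a).1 (u n a)) :=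
      fun n a => by simp [W, hY, Finset.prod_range_succ]
    have hWm : Measurable (W n) := measurable_of_recursion hu hst hW0 hW n
    have hWi : IndepFun (W n) (u n) P := indepFun_of_recursion hu hind hst hW0 hW n
    have hmap := (indepFun_iff_map_prod_eq_prod_map_map hWm.aemeasurable
      (hu n).aemeasurable).1 hWi
    have hH : Measurable fun q : (V × ℝ≥0∞) × U => q.1.2 * F q.1.1 q.2 :=
      Measurable.mul (by fun_prop)
        (hF.comp (f := fun q : (V × ℝ≥0∞) × U => (q.1.1, q.2)) (by fun_prop))
    have : IsProbabilityMeasure (P.map (W n)) := Measure.isProbabilityMeasure_map hWm.aemeasurable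
    calc ∫⁻ a, ∏ j ∈ Finset.range (n + 1), F (Y j a) (u j a) ∂P
        = ∫⁻ a, (fun q : (V × ℝ≥0∞) × U => q.1.2 * F q.1.1 q.2) (W n a, u n a) ∂P := by
          simp [W, Finset.prod_range_succ]
      _ = ∫⁻ q, q.1.2 * F q.1.1 q.2 ∂(P.map fun a => (W n a, u n a)) :=
          (lintegral_map hH (hWm.prodMk (hu n))).symm
      _ = ∫⁻ p, ∫⁻ z, p.2 * F p.1 z ∂μ ∂(P.map (W n)) := by
          rw [hmap, hlaw, lintegral_prod _ hH.aemeasurable]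
      _ ≤ ∫⁻ p, p.2 * C ∂(P.map (W n)) := by
          refine lintegral_mono fun p => ?_
          rw [lintegral_const_mul _ hF.of_uncurry_left]
          gcongr
          exact hC _
      _ = (∫⁻ a, ∏ j ∈ Finset.range n, F (Y j a) (u j a) ∂P) * C := by
          rw [lintegral_map (by fun_prop) hWm, lintegral_mul_const _ hWm.snd]
      _ ≤ C ^ (n + 1) := by
          rw [pow_succ]
          gcongr

end Chain

/-! ### Exponential moments of Gaussian quadratics -/

section Gaussian

/-- Completing the square turns the weighted standard density into `√v * exp (a ^ 2 * v / 2)` times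
the density of mean `a * v` and variance `v = 1 / (1 - x)`. For `x ≤ 1 / 2` one has `v ≤ 2` and `√v
≤ exp x`. -/
lemma lintegral_exp_quadratic_gaussianReal (a : ℝ) {x : ℝ} (hx : 0 ≤ x) (hx' : x ≤ 1 / 2) :
    ∫⁻ y, ENNReal.ofReal (Real.exp (a * y + x / 2 * y ^ 2)) ∂(gaussianReal 0 1)
      ≤ ENNReal.ofReal (Real.exp (a ^ 2 + x)) := by
  have h1 : 0 < 1 - x := by linarith
  set v : NNReal := ⟨(1 - x)⁻¹, by positivity⟩ with hv
  have hvx : (v : ℝ) = (1 - x)⁻¹ := rfl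
  have hv0 : v ≠ 0 := fun h => by
    have : (v : ℝ) = 0 := by rw [h]; rfl
    rw [hvx] at this
    exact (inv_pos.2 h1).ne' this
  have key : ∀ y : ℝ, gaussianPDF 0 1 y * ENNReal.ofReal (Real.exp (a * y + x / 2 * y ^ 2))
      = ENNReal.ofReal (√v * Real.exp (a ^ 2 * v / 2)) * gaussianPDF (a * v) v y := by
    intro y
    rw [gaussianPDF, gaussianPDF, ← ENNReal.ofReal_mul (gaussianPDFReal_nonneg _ _ _),
      ← ENNReal.ofReal_mul (by positivity)]
    congr 1
    rw [gaussianPDFReal, gaussianPDFReal, mul_assoc, ← Real.exp_add]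
    have : √(2 * Real.pi * v) = √(2 * Real.pi) * √v := Real.sqrt_mul (by positivity) _
    rw [this, NNReal.coe_one, mul_one]
    have hs : √(v : ℝ) ≠ 0 := (Real.sqrt_pos.2 (by rw [hvx]; positivity)).ne'
    have hp : √(2 * Real.pi) ≠ 0 := (Real.sqrt_pos.2 (by positivity)).ne'
    have : -(y - 0) ^ 2 / (2 * 1) + (a * y + x / 2 * y ^ 2)
        = a ^ 2 * v / 2 + -(y - a * v) ^ 2 / (2 * v) := by
      rw [hvx]
      field_simp
      ring
    rw [this, Real.exp_add]
    field_simp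
  have hsq : √(v : ℝ) ≤ Real.exp x := by
    rw [Real.sqrt_le_iff]
    refine ⟨(Real.exp_pos _).le, ?_⟩
    rw [hvx, ← Real.exp_nat_mul, inv_le_comm₀ h1 (Real.exp_pos _), ← Real.exp_neg]
    have hq := Real.quadratic_le_exp_of_nonneg (x := (2 : ℕ) * x) (by positivity)
    rw [Real.exp_neg]
    refine inv_le_of_inv_le₀ h1 ?_
    refine le_trans ?_ hq
    rw [inv_le_iff_one_le_mul₀ h1]
    push_cast
    nlinarith [mul_nonneg hx hx]
  have hv2 : (v : ℝ) ≤ 2 := by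
    rw [hvx, inv_le_comm₀ h1 two_pos]
    linarith
  rw [gaussianReal_of_var_ne_zero _ one_ne_zero,
    lintegral_withDensity_eq_lintegral_mul _ (measurable_gaussianPDF _ _) (by fun_prop)]
  simp only [Pi.mul_apply, key]
  rw [lintegral_const_mul _ (measurable_gaussianPDF _ _), lintegral_gaussianPDF_eq_one _ hv0,
    mul_one]
  refine ENNReal.ofReal_le_ofReal ?_
  rw [add_comm, Real.exp_add]
  gcongr
  nlinarith [sq_nonneg a]

open scoped MatrixOrder Matrix.Norms.L2Operator in
lemma gaussianNoise_eq_map (d : ℕ) {sw : ℝ} (hsw : 0 ≤ sw) :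
    gaussianNoise d sw = (Measure.pi fun _ : Fin d => gaussianReal 0 1).map
      (fun y => sw • WithLp.toLp 2 y) := by
  have hsq : CFC.sqrt (sw ^ 2 • (1 : Matrix (Fin d) (Fin d) ℝ)) = sw • 1 := by
    refine CFC.sqrt_unique (by rw [smul_mul_smul_comm, mul_one, sq]) ?_
    exact (Matrix.PosSemidef.one.smul hsw).nonneg
  rw [gaussianNoise, multivariateGaussian, hsq, ← map_pi_eq_stdGaussian,
    Measure.map_map (by fun_prop) (by fun_prop)]
  congr 1
  ext y
  simp

/-- The integrand factors over independent standard coordinates, each an instance of the scalar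
bound with `a = sw * p i` and `x = 2 * q * sw ^ 2`. -/
lemma lintegral_exp_quadratic_gaussianNoise {d : ℕ} {sw : ℝ} (hsw : 0 ≤ sw) (p : E d) {q : ℝ}
    (hq : 0 ≤ q) (hq' : 2 * q * sw ^ 2 ≤ 1 / 2) :
    ∫⁻ w, ENNReal.ofReal (Real.exp (inner ℝ p w + q * ‖w‖ ^ 2)) ∂(gaussianNoise d sw)
      ≤ ENNReal.ofReal (Real.exp (‖p‖ ^ 2 * sw ^ 2 + d * (2 * q * sw ^ 2))) := by
  rw [gaussianNoise_eq_map d hsw, lintegral_map (by fun_prop) (by fun_prop)]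
  have h : ∀ y : Fin d → ℝ, ENNReal.ofReal (Real.exp (inner ℝ p (sw • WithLp.toLp 2 y)
      + q * ‖sw • WithLp.toLp 2 y‖ ^ 2)) = ∏ i, ENNReal.ofReal (Real.exp (sw * p i * y i +
        2 * q * sw ^ 2 / 2 * y i ^ 2)) := by
    intro y
    rw [← ENNReal.ofReal_prod_of_nonneg fun _ _ => (Real.exp_pos _).le, ← Real.exp_sum]
    congr 2
    rw [norm_smul, mul_pow, EuclideanSpace.real_norm_sq_eq, inner_smul_right, PiLp.inner_apply,
      Finset.sum_add_distrib, ← Finset.mul_sum, Real.norm_eq_abs, sq_abs, Finset.mul_sum]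
    simp only [RCLike.inner_apply, conj_trivial]
    congr 1
    · exact Finset.sum_congr rfl fun i _ => by ring
    · ring
  simp only [h]
  rw [lintegral_prod_eq_prod_lintegral_of_indepFun Finset.univ
    (fun i (y : Fin d → ℝ) => ENNReal.ofReal (Real.exp (sw * p i * y i +
        2 * q * sw ^ 2 / 2 * y i ^ 2)))
    (iIndepFun_pi (X := fun i (t : ℝ) => ENNReal.ofReal (Real.exp (sw * p i * t +
        2 * q * sw ^ 2 / 2 * t ^ 2))) fun i => by fun_prop) fun i => by fun_prop]
  calc _ ≤ ∏ i, ENNReal.ofReal (Real.exp ((sw * p i) ^ 2 + 2 * q * sw ^ 2)) := by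
        refine Finset.prod_le_prod' fun i _ => ?_
        rw [(measurePreserving_eval (fun _ : Fin d => gaussianReal 0 1) i).lintegral_comp
          (f := fun t : ℝ => ENNReal.ofReal (Real.exp (sw * p i * t +
            2 * q * sw ^ 2 / 2 * t ^ 2))) (by fun_prop)]
        exact lintegral_exp_quadratic_gaussianReal _ (by positivity) hq'
    _ = _ := by
        rw [← ENNReal.ofReal_prod_of_nonneg fun _ _ => (Real.exp_pos _).le, ← Real.exp_sum,
          Finset.sum_add_distrib, EuclideanSpace.real_norm_sq_eq, Finset.sum_mul]
        simp [mul_pow, mul_comm]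

end Gaussian

/-! ### Geometry of the clipping operator -/

section Clip

variable {d : ℕ}

lemma norm_clip_le (x : E d) {l : ℝ} (hl : 0 ≤ l) : ‖clip x l‖ ≤ l := by
  rw [clip, norm_smul, Real.norm_of_nonneg (by positivity)]
  rcases eq_or_ne ‖x‖ 0 with h | h
  · simpa [h] using hl
  · calc min 1 (l / ‖x‖) * ‖x‖ ≤ l / ‖x‖ * ‖x‖ := by gcongr; exact min_le_right _ _
      _ = l := div_mul_cancel₀ _ h

lemma clip_of_norm_le {x : E d} {l : ℝ} (h : ‖x‖ ≤ l) : clip x l = x := by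
  rcases eq_or_ne x 0 with rfl | hx
  · simp [clip]
  · rw [clip, min_eq_left, one_smul]
    rwa [one_le_div (norm_pos_iff.2 hx)]

lemma clip_of_le_norm {x : E d} {l : ℝ} (h : l ≤ ‖x‖) : clip x l = (l / ‖x‖) • x := by
  rw [clip, min_eq_right (div_le_one_of_le₀ h (norm_nonneg _))]

lemma norm_self_sub_clip (x : E d) {l : ℝ} (hl : 0 ≤ l) : ‖x - clip x l‖ = max 0 (‖x‖ - l) := by
  rcases le_or_gt ‖x‖ l with h | h
  · rw [clip_of_norm_le h, sub_self, norm_zero, max_eq_left (by linarith)]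
  · have hx : 0 < ‖x‖ := hl.trans_lt h
    rw [clip_of_le_norm h.le, max_eq_right (by linarith)]
    have : x - (l / ‖x‖) • x = (1 - l / ‖x‖) • x := by rw [sub_smul, one_smul]
    rw [this, norm_smul, Real.norm_of_nonneg (sub_nonneg.2 (div_le_one_of_le₀ h.le hx.le))]
    field_simp

/-- Clipping is the projection onto a ball, hence does not increase the distance to its points. -/
lemma norm_clip_sub_le (x : E d) {y : E d} {l : ℝ} (hy : ‖y‖ ≤ l) : ‖clip x l - y‖ ≤ ‖x - y‖ := by
  rcases le_or_gt ‖x‖ l with h | h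
  · rw [clip_of_norm_le h]
  · have hx : 0 < ‖x‖ := ((norm_nonneg y).trans hy).trans_lt h
    rw [clip_of_le_norm h.le]
    set t := l / ‖x‖ with ht
    have ht1 : t ≤ 1 := div_le_one_of_le₀ h.le hx.le
    have htl : t * ‖x‖ = l := div_mul_cancel₀ _ hx.ne'
    refine le_of_sq_le_sq ?_ (norm_nonneg _)
    have hin : inner ℝ x y ≤ ‖x‖ * l :=
      (real_inner_le_norm x y).trans (by gcongr)
    rw [norm_sub_sq_real, norm_sub_sq_real, inner_smul_left, norm_smul, Real.norm_eq_abs, mul_pow,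
      sq_abs]
    simp only [conj_trivial]
    have h3 : 0 ≤ (1 - t) * ((1 + t) * ‖x‖ ^ 2 - 2 * inner ℝ x y) := by
      refine mul_nonneg (by linarith) ?_
      have : (1 + t) * ‖x‖ ^ 2 = ‖x‖ * (‖x‖ + l) := by rw [← htl]; ring
      rw [this]
      nlinarith
    linarith

@[fun_prop]
lemma measurable_clip {T : Type*} [MeasurableSpace T] {g : T → E d} (hg : Measurable g) (l : ℝ) :
    Measurable fun t => clip (g t) l := by
  unfold clip
  fun_prop

end Clip

/-! ### Bias, variance and exponential moments under clipping -/

section Moments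

variable {d : ℕ} {S : Type*} [MeasurableSpace S] {D : Measure S}

lemma add_rpow_le {a b p : ℝ} (ha : 0 ≤ a) (hb : 0 ≤ b) (hp : 1 ≤ p) :
    (a + b) ^ p ≤ 2 ^ (p - 1) * (a ^ p + b ^ p) := by
  lift a to NNReal using ha
  lift b to NNReal using hb
  exact_mod_cast NNReal.rpow_add_le_mul_rpow_add_rpow a b hp

variable {X : S → E d} {g h : E d} {σ α ζ lam : ℝ}

lemma rpow_norm_sub_le (hα : 1 < α) (hg : ‖g - h‖ ≤ ζ) (x : E d) :
    ‖x - h‖ ^ α ≤ 2 ^ (α - 1) * (‖x - g‖ ^ α + ζ ^ α) := by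
  refine le_trans ?_ (add_rpow_le (norm_nonneg _) ((norm_nonneg _).trans hg) hα.le)
  refine Real.rpow_le_rpow (norm_nonneg _) ?_ (by linarith)
  calc ‖x - h‖ = ‖(x - g) + (g - h)‖ := by rw [sub_add_sub_cancel]
    _ ≤ _ := (norm_add_le _ _).trans (by gcongr)

/-- Second moment of the clipping error. -/
lemma integral_sq_norm_clip_sub_le (hα : 1 < α) (hα' : α ≤ 2) (hlam : 0 < lam)
    (hh : ‖h‖ ≤ lam / 2) (hint : Integrable (fun s => ‖X s - h‖ ^ α) D) :
    ∫ s, ‖clip (X s) lam - h‖ ^ 2 ∂D ≤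
      (3 / 2 * lam) ^ (2 - α) * ∫ s, ‖X s - h‖ ^ α ∂D := by
  have hb : ∀ s, ‖clip (X s) lam - h‖ ≤ 3 / 2 * lam := fun s =>
    (norm_sub_le _ _).trans (by linarith [norm_clip_le (X s) hlam.le])
  rw [← integral_const_mul]
  have hpt : ∀ s, ‖clip (X s) lam - h‖ ^ 2 ≤ (3 / 2 * lam) ^ (2 - α) * ‖X s - h‖ ^ α := by
    intro s
    -- Interpolation: the factor of order `2 - α` is bounded by boundedness of the error, the factor
    -- of order `α` by nonexpansiveness of clipping.
    have h2 : ‖clip (X s) lam - h‖ ^ 2 =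
        ‖clip (X s) lam - h‖ ^ (2 - α) * ‖clip (X s) lam - h‖ ^ α := by
      rw [← Real.rpow_add_of_nonneg (norm_nonneg _) (by linarith) (by linarith),
        sub_add_cancel, Real.rpow_two]
    rw [h2]
    exact mul_le_mul (Real.rpow_le_rpow (norm_nonneg _) (hb s) (by linarith))
      (Real.rpow_le_rpow (norm_nonneg _) (norm_clip_sub_le _ (by linarith)) (by linarith))
      (by positivity) (by positivity)
  refine integral_mono_of_nonneg (.of_forall fun s => by positivity) (hint.const_mul _)
    (.of_forall hpt)

variable [IsProbabilityMeasure D]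

lemma integrable_rpow_norm_sub (hα : 1 < α) (hX : Measurable X)
    (hint : Integrable (fun s => ‖X s - g‖ ^ α) D) (hg : ‖g - h‖ ≤ ζ) :
    Integrable (fun s => ‖X s - h‖ ^ α) D := by
  refine Integrable.mono' ((hint.add (integrable_const (ζ ^ α))).const_mul (2 ^ (α - 1)))
    ((hX.sub_const h).norm.pow_const α).aestronglyMeasurable (.of_forall fun s => ?_)
  rw [Real.norm_of_nonneg (by positivity)]
  exact rpow_norm_sub_le hα hg _

lemma integral_rpow_norm_sub_le (hα : 1 < α) (hX : Measurable X)
    (hint : Integrable (fun s => ‖X s - g‖ ^ α) D) (hle : ∫ s, ‖X s - g‖ ^ α ∂D ≤ σ ^ α)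
    (hg : ‖g - h‖ ≤ ζ) :
    ∫ s, ‖X s - h‖ ^ α ∂D ≤ 2 ^ (α - 1) * (σ ^ α + ζ ^ α) := by
  calc ∫ s, ‖X s - h‖ ^ α ∂D ≤ ∫ s, 2 ^ (α - 1) * (‖X s - g‖ ^ α + ζ ^ α) ∂D := by
        refine integral_mono (integrable_rpow_norm_sub hα hX hint hg)
          ((hint.add (integrable_const (ζ ^ α))).const_mul (2 ^ (α - 1))) fun s => ?_
        exact rpow_norm_sub_le hα hg _
    _ = 2 ^ (α - 1) * (∫ s, ‖X s - g‖ ^ α ∂D + ζ ^ α) := by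
        rw [integral_const_mul, integral_add hint (integrable_const _)]
        simp
    _ ≤ _ := by gcongr

/-- Bias of the clipped vector. -/
lemma norm_integral_clip_sub_le (hα : 1 < α) (hlam : 0 < lam)
    (hX : Measurable X) (hXi : Integrable X D) (hXg : ∫ s, X s ∂D = g) (hg : ‖g - h‖ ≤ ζ)
    (hh : ‖h‖ ≤ lam / 2) (hint : Integrable (fun s => ‖X s - h‖ ^ α) D) :
    ‖∫ s, (clip (X s) lam - h) ∂D‖ ≤ ζ + (lam / 2) ^ (1 - α) * ∫ s, ‖X s - h‖ ^ α ∂D := by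
  have hci : Integrable (fun s => X s - clip (X s) lam) D :=
    hXi.sub (Integrable.of_bound (measurable_clip hX lam).aestronglyMeasurable lam
      (.of_forall fun s => norm_clip_le _ hlam.le))
  -- The bias splits into the shift `g - h` of the reference vector and the tail removed by
  -- clipping. Since `‖h‖ ≤ lam / 2`, that tail is nonzero only where `‖X s - h‖ > lam / 2`, and
  -- there the `α`-th power dominates.
  have h1 : ∫ s, (clip (X s) lam - h) ∂D = (g - h) - ∫ s, (X s - clip (X s) lam) ∂D := by
    have : ∀ s, clip (X s) lam - h = (X s - h) - (X s - clip (X s) lam) := fun s => by abel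
    simp only [this]
    have hXh : Integrable (fun s => X s - h) D := hXi.sub (integrable_const _)
    rw [integral_sub hXh hci, integral_sub hXi (integrable_const _), hXg]
    simp
  rw [h1]
  refine (norm_sub_le _ _).trans (add_le_add hg ?_)
  refine (norm_integral_le_integral_norm _).trans ?_
  rw [← integral_const_mul]
  refine integral_mono hci.norm (hint.const_mul _) fun s => ?_
  simp only [norm_self_sub_clip _ hlam.le]
  have htri : ‖X s‖ ≤ ‖X s - h‖ + ‖h‖ := by
    simpa using norm_add_le (X s - h) h
  set r := ‖X s - h‖ with hr
  rcases le_or_gt r (lam / 2) with hc | hc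
  · rw [max_eq_left (by linarith)]
    positivity
  · have hr0 : 0 < r := by linarith
    have : r ≤ (lam / 2) ^ (1 - α) * r ^ α := by
      calc r = r ^ (1 - α) * r ^ α := by
            rw [← Real.rpow_add hr0, sub_add_cancel, Real.rpow_one]
        _ ≤ _ := by
            gcongr ?_ * _
            exact Real.rpow_le_rpow_of_nonpos (by positivity) hc.le (by linarith)
    exact max_le (by positivity) (by linarith)

/-- Exponential moment of a small bounded random variable. -/
lemma integral_exp_le_of_abs_le_one {Y : S → ℝ} (hY : Measurable Y) (h1 : ∀ s, |Y s| ≤ 1)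
    {m v : ℝ} (hm : ∫ s, Y s ∂D ≤ m) (hv : ∫ s, Y s ^ 2 ∂D ≤ v) :
    ∫⁻ s, ENNReal.ofReal (Real.exp (Y s)) ∂D ≤ ENNReal.ofReal (Real.exp (m + v)) := by
  have hYi : Integrable Y D := Integrable.of_bound (by fun_prop) 1 (.of_forall h1)
  have hY2 : Integrable (fun s => Y s ^ 2) D := by
    refine Integrable.of_bound (by fun_prop) 1 (.of_forall fun s => ?_)
    rw [norm_pow]
    exact pow_le_one₀ (norm_nonneg _) (h1 s)
  have hYe : Integrable (fun s => Real.exp (Y s)) D := by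
    refine Integrable.of_bound (by fun_prop) (Real.exp 1) (.of_forall fun s => ?_)
    rw [Real.norm_of_nonneg (Real.exp_pos _).le]
    exact Real.exp_le_exp.2 ((le_abs_self _).trans (h1 s))
  rw [← ofReal_integral_eq_lintegral_ofReal hYe (.of_forall fun s => (Real.exp_pos _).le)]
  refine ENNReal.ofReal_le_ofReal ?_
  calc ∫ s, Real.exp (Y s) ∂D ≤ ∫ s, (1 + Y s + Y s ^ 2) ∂D := by
        refine integral_mono hYe (((integrable_const 1).add hYi).add hY2) fun s => ?_
        have := (abs_le.1 (Real.abs_exp_sub_one_sub_id_le (h1 s))).2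
        simp only
        linarith
    _ = 1 + ∫ s, Y s ∂D + ∫ s, Y s ^ 2 ∂D := by
        have h1Y : Integrable (fun s => 1 + Y s) D := (integrable_const 1).add hYi
        rw [integral_add h1Y hY2,
          integral_add (integrable_const 1) hYi]
        simp
    _ ≤ Real.exp (m + v) := by
        linarith [Real.add_one_le_exp (m + v)]

end Moments

/-! ### Consequences of the step-size condition -/

section StepSize

/-- Bound on the second moment of the clipping error. -/
noncomputable def errVar (L R lam σ α : ℝ) : ℝ :=
  (3 / 2 * lam) ^ (2 - α) * (2 ^ (α - 1) * (σ ^ α + zeta L R lam ^ α))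

/-- Bound on the norm of the mean clipping error. -/
noncomputable def errBias (L R lam σ α : ℝ) : ℝ :=
  zeta L R lam + (lam / 2) ^ (1 - α) * (2 ^ (α - 1) * (σ ^ α + zeta L R lam ^ α))

lemma zeta_nonneg (L R lam : ℝ) : 0 ≤ zeta L R lam := le_max_left _ _

variable {d : ℕ} {γ L R lam σ α sw β : ℝ} {K : ℕ}

lemma errVar_nonneg (hσ : 0 < σ) (hlam : 0 < lam) : 0 ≤ errVar L R lam σ α := by
  have := zeta_nonneg L R lam
  unfold errVar
  positivity

lemma log_eight_ge_two : (2 : ℝ) ≤ Real.log 8 := by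
  have : (8 : ℝ) = 2 ^ 3 := by norm_num
  rw [this, Real.log_pow]
  push_cast
  linarith [Real.log_two_gt_d9]

lemma two_le_log (hβ : 0 < β) (hβ' : β ≤ 1) : 2 ≤ Real.log (8 * (K + 1) / β) := by
  refine log_eight_ge_two.trans (Real.log_le_log (by norm_num) ?_)
  rw [le_div_iff₀ hβ]
  have : (0 : ℝ) ≤ K := K.cast_nonneg
  nlinarith

/-- The two logarithms differ by `log 2`, which is at most half of the smaller one. This converts
the logarithm in the noise conditions into that of the Chernoff parameter. -/
lemma log_le_three_halves_log (hβ : 0 < β) (hβ' : β ≤ 1) :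
    Real.log (8 * (K + 1) / β) ≤ 3 / 2 * Real.log (4 * (K + 1) / β) := by
  have hK : (0 : ℝ) ≤ K := K.cast_nonneg
  have h1 : 8 * ((K : ℝ) + 1) / β = 2 * (4 * (K + 1) / β) := by ring
  have h2 : Real.log 4 ≤ Real.log (4 * (K + 1) / β) := by
    refine Real.log_le_log (by norm_num) ?_
    rw [le_div_iff₀ hβ]
    nlinarith
  have h3 : Real.log 4 = 2 * Real.log 2 := by
    rw [show (4 : ℝ) = 2 ^ 2 by norm_num, Real.log_pow]
    norm_num
  rw [h1, Real.log_mul two_ne_zero (by positivity)]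
  linarith

lemma StepSizeCond.pos_radius (h : StepSizeCond d γ L R lam σ α sw β K) (hγ : 0 < γ)
    (hR : 0 ≤ R) : 0 < R := by
  refine hR.lt_of_ne fun h0 => ?_
  have := h.le_one
  rw [gamma1, ← h0, zero_div] at this
  linarith

lemma sigma_rpow_mul (hσ : 0 < σ) (z : ℝ) : σ ^ α * (1 + z ^ α / σ ^ α) = σ ^ α + z ^ α := by
  have : σ ^ α ≠ 0 := (Real.rpow_pos_of_pos hσ _).ne'
  field_simp

lemma errVar_le (hσ : 0 < σ) (hlam : 0 < lam) (hα : 1 < α) (hα' : α ≤ 2) :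
    errVar L R lam σ α ≤ (2 ^ (2 * α - 1) + 1) *
      (lam ^ (2 - α) * (σ ^ α + zeta L R lam ^ α)) := by
  have hz := zeta_nonneg L R lam
  have h1 : (3 / 2 : ℝ) ^ (2 - α) * 2 ^ (α - 1) ≤ 2 ^ (2 * α - 1) + 1 := by
    calc (3 / 2 : ℝ) ^ (2 - α) * 2 ^ (α - 1) ≤ 2 ^ (2 - α) * 2 ^ (α - 1) := by
          gcongr
          norm_num
      _ = 2 ^ (1 : ℝ) := by rw [← Real.rpow_add two_pos]; congr 1; ring
      _ ≤ 2 ^ (2 * α - 1) := Real.rpow_le_rpow_of_exponent_le one_le_two (by linarith)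
      _ ≤ _ := by linarith
  calc errVar L R lam σ α
      = ((3 / 2 : ℝ) ^ (2 - α) * 2 ^ (α - 1)) *
        (lam ^ (2 - α) * (σ ^ α + zeta L R lam ^ α)) := by
        rw [errVar, Real.mul_rpow (by norm_num) hlam.le]
        ring
    _ ≤ _ := by gcongr

/-- The square of the bound `gamma1`, with `10584 = 42 ^ 2 * 6`. -/
lemma StepSizeCond.errVar_le (h : StepSizeCond d γ L R lam σ α sw β K) (hγ : 0 < γ)
    (hσ : 0 < σ) (hlam : 0 < lam) (hα : 1 < α) (hα' : α ≤ 2) (hβ : 0 < β) (hβ' : β ≤ 1) :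
    10584 * (γ ^ 2 * (K + 1) * Real.log (8 * (K + 1) / β) * errVar L R lam σ α) ≤ R ^ 2 := by
  have hz := zeta_nonneg L R lam
  have hl := two_le_log (K := K) hβ hβ'
  have h1 := h.le_one
  set ℓ := Real.log (8 * (K + 1) / β)
  have hl0 : 0 < ℓ := by linarith
  rw [gamma1, le_div_iff₀ (by positivity)] at h1
  have h2 := pow_le_pow_left₀ (by positivity) h1 2
  have sq1 : (((2 : ℝ) ^ (2 * α - 1) + 1) ^ (1 / 2 : ℝ)) ^ 2 = 2 ^ (2 * α - 1) + 1 := by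
    rw [← Real.sqrt_eq_rpow, Real.sq_sqrt (by positivity)]
  have sq2 : (σ ^ (α / 2)) ^ 2 = σ ^ α := by
    rw [← Real.rpow_mul_natCast hσ.le]
    congr 1
    push_cast
    ring
  have sq3 : (lam ^ (1 - α / 2)) ^ 2 = lam ^ (2 - α) := by
    rw [← Real.rpow_mul_natCast hlam.le]
    congr 1
    push_cast
    ring
  have sq4 : √(6 * (K + 1) * ℓ * (1 + zeta L R lam ^ α / σ ^ α)) ^ 2 =
      6 * (K + 1) * ℓ * (1 + zeta L R lam ^ α / σ ^ α) := Real.sq_sqrt (by positivity)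
  rw [mul_pow, mul_pow, mul_pow, mul_pow, mul_pow, sq1, sq2, sq3, sq4] at h2
  have hs := sigma_rpow_mul (α := α) hσ (zeta L R lam)
  calc 10584 * (γ ^ 2 * (K + 1) * ℓ * errVar L R lam σ α)
      ≤ 10584 * (γ ^ 2 * (K + 1) * ℓ * ((2 ^ (2 * α - 1) + 1) *
      (lam ^ (2 - α) * (σ ^ α + zeta L R lam ^ α)))) := by
        gcongr
        exact DPClippedSGD.errVar_le hσ hlam hα hα'
    _ = γ ^ 2 * (42 ^ 2 * (2 ^ (2 * α - 1) + 1) * σ ^ α * lam ^ (2 - α) *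
          (6 * (K + 1) * ℓ * (1 + zeta L R lam ^ α / σ ^ α))) := by
        rw [← hs]
        ring
    _ ≤ R ^ 2 := h2

lemma StepSizeCond.errBias_le (h : StepSizeCond d γ L R lam σ α sw β K) (hγ : 0 < γ)
    (hσ : 0 < σ) (hlam : 0 < lam) :
    28 * (γ * (K + 1) * errBias L R lam σ α) ≤ R := by
  have hz := zeta_nonneg L R lam
  have h2 := h.le_two
  have hp : 0 < lam ^ (α - 1) := by positivity
  rw [gamma2, le_div_iff₀ (by positivity)] at h2
  refine le_of_mul_le_mul_right ?_ hp
  refine le_trans ?_ h2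
  have hs := sigma_rpow_mul (α := α) hσ (zeta L R lam)
  set z := zeta L R lam
  set a : ℝ := 2 ^ (2 * α - 1)
  have ha : 0 < a := by positivity
  have hw : 0 < σ ^ α + z ^ α := by positivity
  have e : errBias L R lam σ α * lam ^ (α - 1) = z * lam ^ (α - 1) + a * (σ ^ α + z ^ α) / 2 := by
    have e1 : (lam / 2) ^ (1 - α) * 2 ^ (α - 1) * lam ^ (α - 1) = a / 2 := by
      rw [Real.div_rpow hlam.le zero_le_two]
      have e2 : lam ^ (1 - α) * lam ^ (α - 1) = 1 := by
        rw [← Real.rpow_add hlam]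
        simp
      have e3 : (2 : ℝ) ^ (α - 1) = a / 2 * 2 ^ (1 - α) := by
        have : a / 2 = 2 ^ (2 * α - 1 - 1) := by rw [Real.rpow_sub_one two_ne_zero (2 * α - 1)]
        rw [this, ← Real.rpow_add two_pos]
        congr 1
        ring
      rw [e3]
      have : (2 : ℝ) ^ (1 - α) ≠ 0 := (by positivity : (0 : ℝ) < 2 ^ (1 - α)).ne'
      field_simp
      linear_combination e2
    rw [errBias]
    linear_combination (σ ^ α + z ^ α) * e1
  calc 28 * (γ * (K + 1) * errBias L R lam σ α) * lam ^ (α - 1)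
      = γ * (28 * (K + 1) * (z * lam ^ (α - 1) + a * (σ ^ α + z ^ α) / 2)) := by
        linear_combination 28 * γ * (K + 1) * e
    -- Two of the four terms in the bracket of `gamma2` reproduce the bias exactly; the zeros stand
    -- for the other two, which are nonnegative.
    _ = γ * (28 * (K + 1) * a * σ ^ α * (1 + z ^ α / σ ^ α) *
          (0 + 1 / 2 + lam ^ (α - 1) * z / (a * (σ ^ α + z ^ α)) + 0)) := by
        rw [mul_assoc _ (σ ^ α), hs]
        field_simp
        ring
    _ ≤ _ := by
        gcongr
        · positivity
        · positivity

lemma StepSizeCond.clip_le (h : StepSizeCond d γ L R lam σ α sw β K)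
    (hlam : 0 < lam) (hβ : 0 < β) (hβ' : β ≤ 1) :
    56 * (γ * lam * Real.log (8 * (K + 1) / β)) ≤ R := by
  have hl := two_le_log (K := K) hβ hβ'
  have h5 := h.le_five
  rw [gamma5, le_div_iff₀ (by positivity)] at h5
  linarith

lemma StepSizeCond.noise_linear_le (h : StepSizeCond d γ L R lam σ α sw β K) (hγ : 0 < γ)
    (hsw : 0 ≤ sw) (hβ : 0 < β) (hβ' : β ≤ 1) :
    12544 * (γ ^ 2 * sw ^ 2 * d * (K + 1) * Real.log (8 * (K + 1) / β)) ≤ R ^ 2 := by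
  have hl := two_le_log (K := K) hβ hβ'
  have hlt := log_le_three_halves_log (K := K) hβ hβ'
  have h3 := h.le_three
  rw [gamma3Den] at h3
  have hφ := Real.sqrt_nonneg (3 * Real.log (4 * ((K : ℝ) + 1) / β))
  have hφ2 : phi β K ^ 2 = 3 * Real.log (4 * (K + 1) / β) := Real.sq_sqrt (by linarith)
  have hφ0 : 0 ≤ phi β K := hφ
  have h4 := pow_le_pow_left₀ (by positivity) h3 2
  rw [mul_pow, mul_pow, mul_pow, mul_pow, Real.sq_sqrt (by positivity)] at h4
  have h5 : (√2 + √2 * phi β K) ^ 2 = 2 * (1 + phi β K) ^ 2 := by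
    have : √2 ^ 2 = (2 : ℝ) := Real.sq_sqrt (by norm_num)
    linear_combination (1 + phi β K) ^ 2 * this
  rw [h5] at h4
  refine le_trans ?_ h4
  -- Already `phi ^ 2`, three times the smaller logarithm, dominates twice the larger one.
  have h6 : 2 * Real.log (8 * (K + 1) / β) ≤ (1 + phi β K) ^ 2 := by nlinarith
  calc _ = γ ^ 2 * (56 ^ 2 * sw ^ 2 * (d * (K + 1)) *
        (2 * (2 * Real.log (8 * (K + 1) / β)))) := by ring
    _ ≤ _ := by gcongr

lemma StepSizeCond.noise_sq_le (h : StepSizeCond d γ L R lam σ α sw β K) (hγ : 0 < γ)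
    (hsw : 0 ≤ sw) (hβ : 0 < β) (hβ' : β ≤ 1) :
    28 * (γ ^ 2 * sw ^ 2 * ((K + 1) * d + 2 * Real.log (4 * (K + 1) / β))) ≤ R ^ 2 := by
  have hl := two_le_log (K := K) hβ hβ'
  have hlt := log_le_three_halves_log (K := K) hβ hβ'
  have ht : 0 ≤ Real.log (4 * ((K : ℝ) + 1) / β) := by linarith
  have h4 := pow_le_pow_left₀ (by unfold gamma6Den; positivity) h.le_six 2
  rw [gamma6Den, mul_pow, mul_pow, mul_pow, Real.sq_sqrt (by positivity)] at h4
  refine le_trans ?_ h4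
  calc _ = γ ^ 2 * (2 ^ 2 * sw ^ 2 * (7 * ((K + 1) * d + 0
        + 2 * Real.log (4 * (K + 1) / β)))) := by ring
    _ ≤ _ := by
      gcongr
      positivity

end StepSize

/-! ### Deterministic estimates for the objective -/

section Objective

variable {d : ℕ} {f : E d → ℝ} {xstar x : E d} {L R lam γ : ℝ}

lemma sq_norm_sub_le_of_mem (hx : x ∈ Metric.closedBall xstar (√2 * R)) :
    ‖x - xstar‖ ^ 2 ≤ 2 * R ^ 2 := by
  rw [mem_closedBall_iff_norm] at hx
  have h := pow_le_pow_left₀ (norm_nonneg _) hx 2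
  rwa [mul_pow, Real.sq_sqrt zero_le_two] at h

lemma mem_closedBall_of_sq_norm_sub_le (hR : 0 ≤ R) (hx : ‖x - xstar‖ ^ 2 ≤ 2 * R ^ 2) :
    x ∈ Metric.closedBall xstar (√2 * R) := by
  rw [mem_closedBall_iff_norm]
  refine le_of_sq_le_sq ?_ (by positivity)
  rwa [mul_pow, Real.sq_sqrt zero_le_two]

lemma mem_closedBall_two_mul (hR : 0 ≤ R) (hx : ‖x - xstar‖ ^ 2 ≤ 4 * R ^ 2) :
    x ∈ Metric.closedBall xstar (2 * R) := by
  rw [mem_closedBall_iff_norm]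
  refine le_of_sq_le_sq ?_ (by positivity)
  linarith

lemma closedBall_subset_closedBall_two_mul (hR : 0 ≤ R) :
    Metric.closedBall xstar (√2 * R) ⊆ Metric.closedBall xstar (2 * R) := fun x hx =>
  mem_closedBall_two_mul hR ((sq_norm_sub_le_of_mem hx).trans (by nlinarith [sq_nonneg R]))

lemma gradient_eq_zero_of_forall_le (hmin : ∀ y, f xstar ≤ f y) : gradient f xstar = 0 := by
  have : IsLocalMin f xstar := Filter.Eventually.of_forall hmin
  rw [gradient, this.fderiv_eq_zero, map_zero]

lemma norm_gradient_le (hR : 0 ≤ R) (hmin : ∀ y, f xstar ≤ f y)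
    (hsmooth : SmoothOnSet f L (Metric.closedBall xstar (2 * R)))
    (hx : x ∈ Metric.closedBall xstar (2 * R)) : ‖gradient f x‖ ≤ L * ‖x - xstar‖ := by
  have := hsmooth.2 x hx xstar (Metric.mem_closedBall_self (by positivity))
  rwa [gradient_eq_zero_of_forall_le hmin, sub_zero] at this

lemma sub_le_inner_gradient (hR : 0 ≤ R)
    (hconv : GradConvexOn f (Metric.closedBall xstar (2 * R)))
    (hx : x ∈ Metric.closedBall xstar (2 * R)) :
    f x - f xstar ≤ inner ℝ (x - xstar) (gradient f x) := by
  have := hconv x hx xstar (Metric.mem_closedBall_self (by positivity))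
  rw [← neg_sub x xstar, inner_neg_right, real_inner_comm] at this
  linarith

/-- The squared gradient norm is controlled by the functional gap: compare `f x` with the value
after a gradient step of length `1 / (2 L)`, which stays in the larger ball. -/
lemma sq_norm_gradient_le (hL : 0 < L) (hR : 0 ≤ R) (hmin : ∀ y, f xstar ≤ f y)
    (hsmooth : SmoothOnSet f L (Metric.closedBall xstar (2 * R)))
    (hconv : GradConvexOn f (Metric.closedBall xstar (2 * R)))
    (hx : x ∈ Metric.closedBall xstar (√2 * R)) :
    ‖gradient f x‖ ^ 2 ≤ 4 * L * (f x - f xstar) := by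
  have hxQ := closedBall_subset_closedBall_two_mul hR hx
  have hx2 := sq_norm_sub_le_of_mem hx
  have hg := norm_gradient_le hR hmin hsmooth hxQ
  have hin := sub_le_inner_gradient hR hconv hxQ
  set g := gradient f x with hgdef
  set t := 1 / (2 * L) with ht
  have ht0 : 0 < t := by positivity
  have hLt : L * t = 1 / 2 := by rw [ht]; field_simp
  have htg : (t * ‖g‖) ^ 2 ≤ R ^ 2 := by
    have : t * ‖g‖ ≤ 1 / 2 * ‖x - xstar‖ := by rw [← hLt]; nlinarith
    have := pow_le_pow_left₀ (by positivity) this 2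
    rw [mul_pow (1 / 2 : ℝ)] at this
    nlinarith
  -- By convexity the inner product of `x - xstar` with `g` is nonnegative, so the step adds at most
  -- `R ^ 2` to a squared distance of at most `2 * R ^ 2`.
  have hy : x - t • g ∈ Metric.closedBall xstar (2 * R) := by
    refine mem_closedBall_two_mul hR ?_
    rw [sub_right_comm, norm_sub_sq_real, inner_smul_right, norm_smul, Real.norm_of_nonneg ht0.le]
    have : 0 ≤ t * inner ℝ (x - xstar) g :=
      mul_nonneg ht0.le (le_trans (sub_nonneg.2 (hmin x)) hin)
    nlinarith [sq_nonneg R]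
  set y := x - t • g
  have hxy : x - y = t • g := sub_sub_cancel _ _
  -- Convexity based at `y` replaces the descent lemma: the gradient at `y` differs from `g` by at
  -- most half of `‖g‖`, so `f` drops by at least `t * ‖g‖ ^ 2 / 2`.
  have h1 := hconv y hy x hxQ
  have h2 := hsmooth.2 x hxQ y hy
  rw [hxy, norm_smul, Real.norm_of_nonneg ht0.le, ← mul_assoc, hLt, ← hgdef] at h2
  rw [hxy, inner_smul_right] at h1
  have h3 : inner ℝ (gradient f y) g = ‖g‖ ^ 2 - inner ℝ (g - gradient f y) g := by
    rw [inner_sub_left, real_inner_self_eq_norm_sq]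
    ring
  have h4 : inner ℝ (g - gradient f y) g ≤ 1 / 2 * ‖g‖ * ‖g‖ :=
    (real_inner_le_norm _ _).trans (by gcongr)
  have h5 : t * (‖g‖ ^ 2 / 2) ≤ f x - f xstar := by
    have : t * (‖g‖ ^ 2 / 2) ≤ t * inner ℝ (gradient f y) g := by
      gcongr
      rw [h3]
      linarith
    linarith [hmin y]
  calc ‖g‖ ^ 2 = 4 * (L * t) * (‖g‖ ^ 2 / 2) := by rw [hLt]; ring
    _ = 4 * L * (t * (‖g‖ ^ 2 / 2)) := by ring
    _ ≤ _ := by gcongr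

/-- The functional gap, damped by the factor by which the gradient is clipped. -/
noncomputable def dampedGap (f : E d → ℝ) (xstar : E d) (lam : ℝ) (x : E d) : ℝ :=
  min 1 (lam / 2 / ‖gradient f x‖) * (f x - f xstar)

lemma dampedGap_nonneg (hmin : ∀ y, f xstar ≤ f y) (hlam : 0 < lam) (x : E d) :
    0 ≤ dampedGap f xstar lam x :=
  mul_nonneg (by positivity) (sub_nonneg.2 (hmin x))

lemma norm_gradient_sub_clip_le (hL : 0 < L) (hR : 0 ≤ R) (hlam : 0 < lam)
    (hmin : ∀ y, f xstar ≤ f y)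
    (hsmooth : SmoothOnSet f L (Metric.closedBall xstar (2 * R)))
    (hx : x ∈ Metric.closedBall xstar (2 * R)) :
    ‖gradient f x - clip (gradient f x) (lam / 2)‖ ≤ zeta L R lam := by
  rw [norm_self_sub_clip _ (by positivity), zeta]
  refine max_le_max le_rfl (sub_le_sub_right ?_ _)
  refine (norm_gradient_le hR hmin hsmooth hx).trans ?_
  rw [mem_closedBall_iff_norm] at hx
  nlinarith

/-- One step of the method with update direction `v + w` decreases the squared distance to the
minimizer up to the noise terms. -/
lemma sq_norm_step_le (hL : 0 < L) (hR : 0 ≤ R) (hlam : 0 < lam) (hγ : 0 < γ)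
    (hγL : γ ≤ 1 / (8 * L)) (hmin : ∀ y, f xstar ≤ f y)
    (hsmooth : SmoothOnSet f L (Metric.closedBall xstar (2 * R)))
    (hconv : GradConvexOn f (Metric.closedBall xstar (2 * R)))
    (hx : x ∈ Metric.closedBall xstar (√2 * R)) (v w : E d) :
    ‖x - γ • (v + w) - xstar‖ ^ 2 ≤ ‖x - xstar‖ ^ 2 - γ * dampedGap f xstar lam x
      + ((-2 * γ * inner ℝ (x - xstar) (v - clip (gradient f x) (lam / 2))
          + 4 * γ ^ 2 * ‖v - clip (gradient f x) (lam / 2)‖ ^ 2)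
        + (-2 * γ * inner ℝ (x - xstar) w + 4 * γ ^ 2 * ‖w‖ ^ 2)) := by
  have hin := sub_le_inner_gradient hR hconv (closedBall_subset_closedBall_two_mul hR hx)
  have hg := sq_norm_gradient_le hL hR hmin hsmooth hconv hx
  rw [dampedGap, clip]
  set g := gradient f x
  set τ := min 1 (lam / 2 / ‖g‖)
  have hτ0 : 0 ≤ τ := by positivity
  have hτ1 : τ ≤ 1 := min_le_left _ _
  set θ := v - τ • g
  have hv : v = τ • g + θ := by simp [θ]
  set η := x - xstar
  have e1 : x - γ • (v + w) - xstar = η - γ • (τ • g + (θ + w)) := by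
    rw [hv, sub_right_comm, add_assoc]
  have e2 : ‖τ • g + (θ + w)‖ ^ 2 ≤ 2 * (τ ^ 2 * ‖g‖ ^ 2) + 4 * ‖θ‖ ^ 2 + 4 * ‖w‖ ^ 2 := by
    have p1 := parallelogram_law_with_norm ℝ (τ • g) (θ + w)
    have p2 := parallelogram_law_with_norm ℝ θ w
    have p3 : ‖τ • g‖ = τ * ‖g‖ := by rw [norm_smul, Real.norm_of_nonneg hτ0]
    rw [p3] at p1
    nlinarith [sq_nonneg ‖τ • g - (θ + w)‖, sq_nonneg ‖θ - w‖]
  have e3 : 8 * L * γ ≤ 1 := by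
    rw [le_div_iff₀ (by positivity)] at hγL
    linarith
  have e4 : 2 * γ ^ 2 * (τ ^ 2 * ‖g‖ ^ 2) ≤ γ * (τ * (f x - f xstar)) := by
    have hgap : 0 ≤ f x - f xstar := sub_nonneg.2 (hmin x)
    -- One factor `τ` is spent so that the squared gradient is absorbed by half of the decrease `2 *
    -- γ * τ * (f x - f xstar)`.
    have hτ2 : τ ^ 2 ≤ τ := by nlinarith
    calc 2 * γ ^ 2 * (τ ^ 2 * ‖g‖ ^ 2) ≤ 2 * γ ^ 2 * (τ * (4 * L * (f x - f xstar))) := by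
          gcongr
      _ = (8 * L * γ) * (γ * (τ * (f x - f xstar))) := by ring
      _ ≤ 1 * (γ * (τ * (f x - f xstar))) := by gcongr
      _ = _ := one_mul _
  have e5 : γ * (τ * (f x - f xstar)) ≤ γ * (τ * inner ℝ η g) := by gcongr
  rw [e1, norm_sub_sq_real, inner_smul_right, inner_add_right, inner_add_right, inner_smul_right,
    norm_smul, Real.norm_of_nonneg hγ.le, mul_pow]
  have e6 : γ ^ 2 * ‖τ • g + (θ + w)‖ ^ 2 ≤
      γ ^ 2 * (2 * (τ ^ 2 * ‖g‖ ^ 2) + 4 * ‖θ‖ ^ 2 + 4 * ‖w‖ ^ 2) := by gcongr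
  linarith

/-- A small damped gap yields a small functional gap. -/
lemma sub_le_of_dampedGap_le (hL : 0 < L) (hR : 0 ≤ R) (hlam : 0 < lam)
    (hmin : ∀ y, f xstar ≤ f y)
    (hsmooth : SmoothOnSet f L (Metric.closedBall xstar (2 * R)))
    (hconv : GradConvexOn f (Metric.closedBall xstar (2 * R)))
    (hx : x ∈ Metric.closedBall xstar (√2 * R)) {q : ℝ} (hq : 0 ≤ q)
    (h : dampedGap f xstar lam x ≤ q) : f x - f xstar ≤ q + 16 * L * q ^ 2 / lam ^ 2 := by
  have hin := sub_le_inner_gradient hR hconv (closedBall_subset_closedBall_two_mul hR hx)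
  have hg := sq_norm_gradient_le hL hR hmin hsmooth hconv hx
  have hgap : 0 ≤ f x - f xstar := sub_nonneg.2 (hmin x)
  rw [dampedGap] at h
  set g := gradient f x
  set Δ := f x - f xstar
  have hpos : 0 ≤ 16 * L * q ^ 2 / lam ^ 2 := by positivity
  rcases eq_or_ne g 0 with h0 | h0
  · rw [h0, inner_zero_right] at hin
    linarith
  have hg0 : 0 < ‖g‖ := norm_pos_iff.2 h0
  rcases le_total 1 (lam / 2 / ‖g‖) with hc | hc
  · rw [min_eq_left hc] at h
    linarith
  · rw [min_eq_right hc, div_mul_eq_mul_div, div_le_iff₀ hg0] at h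
    suffices Δ ≤ 16 * L * q ^ 2 / lam ^ 2 by linarith
    rw [le_div_iff₀ (by positivity)]
    rcases hgap.eq_or_lt with hz | hz
    · rw [← hz, zero_mul]
      positivity
    · refine le_of_mul_le_mul_left ?_ hz
      -- In the clipped case `lam / 2 * Δ ≤ q * ‖g‖`. After squaring, `‖g‖ ^ 2 ≤ 4 * L * Δ` makes
      -- one factor `Δ` cancel.
      have h2 := pow_le_pow_left₀ (by positivity) h 2
      calc Δ * (Δ * lam ^ 2) = 4 * (lam / 2 * Δ) ^ 2 := by ring
        _ ≤ 4 * (q * ‖g‖) ^ 2 := by gcongr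
        _ = 4 * q ^ 2 * ‖g‖ ^ 2 := by ring
        _ ≤ 4 * q ^ 2 * (4 * L * Δ) := by gcongr
        _ = _ := by ring

end Objective

/-! ### Exponential moment of one increment -/

section OneStep

variable {d : ℕ} {S : Type*} [MeasurableSpace S] {D : Measure S} [IsProbabilityMeasure D]
  {f : E d → ℝ} {G : E d → S → E d} {xstar x : E d} {L R lam γ σ α sw β s : ℝ} {K : ℕ}

/-- The contribution of the stochastic gradient to the growth of the squared distance. -/
noncomputable def oracleIncr (f : E d → ℝ) (G : E d → S → E d) (xstar : E d) (γ lam : ℝ) (x : E d)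
    (ξ : S) : ℝ :=
  -2 * γ * inner ℝ (x - xstar) (clip (G x ξ) lam - clip (gradient f x) (lam / 2))
    + 4 * γ ^ 2 * ‖clip (G x ξ) lam - clip (gradient f x) (lam / 2)‖ ^ 2

/-- The contribution of the privacy noise to the growth of the squared distance. -/
noncomputable def noiseIncr (xstar : E d) (γ : ℝ) (x w : E d) : ℝ :=
  -2 * γ * inner ℝ (x - xstar) w + 4 * γ ^ 2 * ‖w‖ ^ 2

lemma measurable_gradient (f : E d → ℝ) : Measurable (gradient f) :=
  (InnerProductSpace.toDual ℝ (E d)).symm.continuous.measurable.comp (measurable_fderiv ℝ f)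

lemma measurable_oracleIncr (hG : Measurable (Function.uncurry G)) :
    Measurable fun p : E d × S => oracleIncr f G xstar γ lam p.1 p.2 := by
  have h1 : Measurable fun p : E d × S => clip (G p.1 p.2) lam := measurable_clip hG lam
  have h2 : Measurable fun p : E d × S => clip (gradient f p.1) (lam / 2) :=
    measurable_clip ((measurable_gradient f).comp measurable_fst) _
  unfold oracleIncr
  fun_prop

lemma measurable_noiseIncr : Measurable fun p : E d × E d => noiseIncr xstar γ p.1 p.2 := by
  unfold noiseIncr
  fun_prop

lemma lintegral_exp_noiseIncr_le (hsw : 0 ≤ sw) (hs : 0 ≤ s)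
    (h : 8 * s * γ ^ 2 * sw ^ 2 ≤ 1 / 2) (hx : x ∈ Metric.closedBall xstar (√2 * R)) :
    ∫⁻ w, ENNReal.ofReal (Real.exp (s * noiseIncr xstar γ x w)) ∂(gaussianNoise d sw) ≤
      ENNReal.ofReal (Real.exp (8 * s ^ 2 * R ^ 2 * (γ ^ 2 * sw ^ 2 * d)
        + 8 * s * (γ ^ 2 * sw ^ 2 * d))) := by
  have hx2 := sq_norm_sub_le_of_mem hx
  -- The spare factor `d` (harmless when `d = 0`, where the space is a point) matches the dimension
  -- in `gamma3Den`.
  have hxd : ‖x - xstar‖ ^ 2 ≤ 2 * R ^ 2 * d := by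
    rcases Nat.eq_zero_or_pos d with rfl | hd
    · simp [Subsingleton.elim x xstar]
    · have : (1 : ℝ) ≤ d := by exact_mod_cast hd
      nlinarith [sq_nonneg R]
  have key := lintegral_exp_quadratic_gaussianNoise (d := d) hsw ((-2 * γ * s) • (x - xstar))
    (q := 4 * s * γ ^ 2) (by positivity) (by linarith)
  refine le_trans (le_of_eq ?_) (key.trans (ENNReal.ofReal_le_ofReal (Real.exp_le_exp.2 ?_)))
  · refine lintegral_congr fun w => ?_
    rw [noiseIncr, real_inner_smul_left]
    congr 2
    ring
  · rw [norm_smul, mul_pow, Real.norm_eq_abs, sq_abs]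
    have : (-2 * γ * s) ^ 2 * ‖x - xstar‖ ^ 2 * sw ^ 2 ≤
        (-2 * γ * s) ^ 2 * (2 * R ^ 2 * d) * sw ^ 2 := by gcongr
    linarith

/-- The scaled increment is bounded by `1`, so its exponential moment is governed by its mean and
second moment. The increment is at most `10 / 3 * γ * R` times the clipping error: `3` from the
inner product (as `√2 ≤ 3 / 2`) and `1 / 3` from the quadratic term, since `γ * lam` is small
against `R`. -/
lemma lintegral_exp_oracleIncr_le (hL : 0 < L) (hR : 0 ≤ R) (hlam : 0 < lam) (hγ : 0 < γ)
    (hα : 1 < α) (hα' : α ≤ 2) (hs : 0 ≤ s) (hγlam : 56 * (γ * lam) ≤ R)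
    (hslam : 5 * s * (γ * lam) * R ≤ 1) (hmin : ∀ y, f xstar ≤ f y)
    (hsmooth : SmoothOnSet f L (Metric.closedBall xstar (2 * R)))
    (hG : Measurable (Function.uncurry G))
    (horacle : OracleOn f G D σ α (Metric.closedBall xstar (2 * R)))
    (hx : x ∈ Metric.closedBall xstar (√2 * R)) :
    ∫⁻ ξ, ENNReal.ofReal (Real.exp (s * oracleIncr f G xstar γ lam x ξ)) ∂D ≤
      ENNReal.ofReal (Real.exp
        (s * (3 * γ * R * errBias L R lam σ α + 4 * γ ^ 2 * errVar L R lam σ α)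
          + 16 * s ^ 2 * γ ^ 2 * R ^ 2 * errVar L R lam σ α)) := by
  have hxQ := closedBall_subset_closedBall_two_mul hR hx
  obtain ⟨⟨hXi, hXg⟩, hXα, hXle⟩ := horacle x hxQ
  have hX : Measurable (G x) := hG.of_uncurry_left
  have hη : ‖x - xstar‖ ≤ 3 / 2 * R := by
    rw [mem_closedBall_iff_norm] at hx
    refine hx.trans (mul_le_mul_of_nonneg_right ?_ hR)
    rw [Real.sqrt_le_left (by norm_num)]
    norm_num
  have hζ := norm_gradient_sub_clip_le hL hR hlam hmin hsmooth hxQ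
  set h := clip (gradient f x) (lam / 2) with hh_def
  have hh : ‖h‖ ≤ lam / 2 := norm_clip_le _ (by positivity)
  have hhα := integrable_rpow_norm_sub hα hX hXα hζ
  have hm := integral_rpow_norm_sub_le hα hX hXα hXle hζ
  have hV : ∫ ξ, ‖clip (G x ξ) lam - h‖ ^ 2 ∂D ≤ errVar L R lam σ α :=
    (integral_sq_norm_clip_sub_le hα hα' hlam hh hhα).trans
      (mul_le_mul_of_nonneg_left hm (by positivity))
  have hB : ‖∫ ξ, (clip (G x ξ) lam - h) ∂D‖ ≤ errBias L R lam σ α :=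
    (norm_integral_clip_sub_le hα hlam hX hXi hXg hζ hh hhα).trans
      (add_le_add_right (mul_le_mul_of_nonneg_left hm (by positivity)) _)
  set θ : S → E d := fun ξ => clip (G x ξ) lam - h with hθ_def
  have hθm : Measurable θ := (measurable_clip hX lam).sub_const h
  have hθb : ∀ ξ, ‖θ ξ‖ ≤ 3 / 2 * lam := fun ξ =>
    (norm_sub_le _ _).trans (by linarith [norm_clip_le (G x ξ) hlam.le])
  have hθi : Integrable θ D := Integrable.of_bound hθm.aestronglyMeasurable _ (.of_forall hθb)
  have hθ2 : Integrable (fun ξ => ‖θ ξ‖ ^ 2) D := by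
    refine Integrable.of_bound (by fun_prop) ((3 / 2 * lam) ^ 2) (.of_forall fun ξ => ?_)
    rw [norm_pow, norm_norm]
    exact pow_le_pow_left₀ (norm_nonneg _) (hθb ξ) 2
  set Y : S → ℝ := fun ξ => oracleIncr f G xstar γ lam x ξ with hY_def
  have hYθ : ∀ ξ, Y ξ = -2 * γ * inner ℝ (x - xstar) (θ ξ) + 4 * γ ^ 2 * ‖θ ξ‖ ^ 2 :=
    fun ξ => rfl
  have hYm : Measurable Y := by
    simp only [funext hYθ]
    fun_prop
  have hYb : ∀ ξ, |Y ξ| ≤ γ * ‖θ ξ‖ * (10 / 3 * R) := by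
    intro ξ
    rw [hYθ]
    refine (abs_add_le _ _).trans ?_
    have a1 : |-2 * γ * inner ℝ (x - xstar) (θ ξ)| ≤ 2 * γ * (3 / 2 * R * ‖θ ξ‖) := by
      rw [abs_mul, abs_mul, abs_of_pos hγ]
      norm_num
      gcongr
      exact (abs_real_inner_le_norm _ _).trans (by gcongr)
    have a2 : |4 * γ ^ 2 * ‖θ ξ‖ ^ 2| ≤ γ * ‖θ ξ‖ * (1 / 3 * R) := by
      rw [abs_of_nonneg (by positivity)]
      calc 4 * γ ^ 2 * ‖θ ξ‖ ^ 2 = γ * ‖θ ξ‖ * (4 * (γ * ‖θ ξ‖)) := by ring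
        _ ≤ γ * ‖θ ξ‖ * (4 * (γ * (3 / 2 * lam))) := by gcongr; exact hθb ξ
        _ ≤ γ * ‖θ ξ‖ * (1 / 3 * R) :=
          mul_le_mul_of_nonneg_left (by linarith) (by positivity)
    linarith
  have hYmean : ∫ ξ, Y ξ ∂D ≤
      3 * γ * R * errBias L R lam σ α + 4 * γ ^ 2 * errVar L R lam σ α := by
    have hin : Integrable (fun ξ => inner ℝ (x - xstar) (θ ξ)) D := hθi.const_inner _
    simp only [hYθ]
    rw [integral_add (hin.const_mul _) (hθ2.const_mul _), integral_const_mul, integral_const_mul,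
      integral_inner hθi]
    have a1 : -inner ℝ (x - xstar) (∫ ξ, θ ξ ∂D) ≤ 3 / 2 * R * errBias L R lam σ α :=
      (neg_le_abs _).trans ((abs_real_inner_le_norm _ _).trans (by gcongr))
    have a2 : 4 * γ ^ 2 * ∫ ξ, ‖θ ξ‖ ^ 2 ∂D ≤ 4 * γ ^ 2 * errVar L R lam σ α := by gcongr
    have a3 := mul_le_mul_of_nonneg_left a1 (by positivity : 0 ≤ 2 * γ)
    linarith
  have hYsq : ∫ ξ, Y ξ ^ 2 ∂D ≤ 16 * γ ^ 2 * R ^ 2 * errVar L R lam σ α := by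
    calc ∫ ξ, Y ξ ^ 2 ∂D ≤ ∫ ξ, 16 * γ ^ 2 * R ^ 2 * ‖θ ξ‖ ^ 2 ∂D := by
          refine integral_mono_of_nonneg (.of_forall fun ξ => sq_nonneg _) (hθ2.const_mul _)
            (.of_forall fun ξ => ?_)
          have := pow_le_pow_left₀ (abs_nonneg _) (hYb ξ) 2
          rw [sq_abs] at this
          have h0 : 0 ≤ γ ^ 2 * R ^ 2 * ‖θ ξ‖ ^ 2 := by positivity
          simp only
          linarith
      _ = 16 * γ ^ 2 * R ^ 2 * ∫ ξ, ‖θ ξ‖ ^ 2 ∂D := integral_const_mul _ _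
      _ ≤ _ := by gcongr
  refine integral_exp_le_of_abs_le_one (Y := fun ξ => s * Y ξ) (by fun_prop) (fun ξ => ?_) ?_ ?_
  · rw [abs_mul, abs_of_nonneg hs]
    calc s * |Y ξ| ≤ s * (γ * (3 / 2 * lam) * (10 / 3 * R)) := by
          gcongr
          exact (hYb ξ).trans (by gcongr; exact hθb ξ)
      _ = 5 * s * (γ * lam) * R := by ring
      _ ≤ 1 := hslam
  · rw [integral_const_mul]
    gcongr
  · simp only [mul_pow]
    rw [integral_const_mul]
    calc s ^ 2 * ∫ ξ, Y ξ ^ 2 ∂D ≤ s ^ 2 * (16 * γ ^ 2 * R ^ 2 * errVar L R lam σ α) := by gcongr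
      _ = _ := by ring

/-- Under the step-size condition, the exponential moment of one increment inside the ball. -/
lemma lintegral_exp_incr_le (hL : 0 < L) (hR : 0 ≤ R) (hlam : 0 < lam) (hγ : 0 < γ)
    (hσ : 0 < σ) (hα : 1 < α) (hα' : α ≤ 2) (hsw : 0 ≤ sw) (hβ : 0 < β) (hβ' : β ≤ 1)
    (hstep : StepSizeCond d γ L R lam σ α sw β K) (hmin : ∀ y, f xstar ≤ f y)
    (hsmooth : SmoothOnSet f L (Metric.closedBall xstar (2 * R)))
    (hG : Measurable (Function.uncurry G))
    (horacle : OracleOn f G D σ α (Metric.closedBall xstar (2 * R)))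
    (hx : x ∈ Metric.closedBall xstar (√2 * R)) :
    ∫⁻ z, ENNReal.ofReal (Real.exp (2 * Real.log (8 * (K + 1) / β) / R ^ 2 *
        (oracleIncr f G xstar γ lam x z.1 + noiseIncr xstar γ x z.2)))
        ∂(D.prod (gaussianNoise d sw)) ≤
      ENNReal.ofReal (Real.exp (Real.log (8 * (K + 1) / β) / (K + 1))) := by
  have hR0 := hstep.pos_radius hγ hR
  have hl := two_le_log (K := K) hβ hβ'
  have hlt := log_le_three_halves_log (K := K) hβ hβ'
  have c1 := hstep.errVar_le hγ hσ hlam hα hα' hβ hβ'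
  have c2 := hstep.errBias_le hγ hσ hlam
  have c5 := hstep.clip_le hlam hβ hβ'
  have c3 := hstep.noise_linear_le hγ hsw hβ hβ'
  have c6 := hstep.noise_sq_le hγ hsw hβ hβ'
  have hV := errVar_nonneg (L := L) (R := R) (α := α) hσ hlam
  set ℓ := Real.log (8 * (K + 1) / β)
  set t := Real.log (4 * (K + 1) / β)
  set V := errVar L R lam σ α
  set B := errBias L R lam σ α
  set s := 2 * ℓ / R ^ 2 with hs_def
  have hs : 0 ≤ s := by positivity
  have hsR : s * R ^ 2 = 2 * ℓ := by rw [hs_def]; field_simp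
  have hN : (0 : ℝ) < K + 1 := by positivity
  have hγlam : 56 * (γ * lam) ≤ R := by
    have : 0 < γ * lam := by positivity
    nlinarith
  have hslam : 5 * s * (γ * lam) * R ≤ 1 := by
    have : s * R * (56 * (γ * lam * ℓ)) ≤ s * R * R := by gcongr
    have h1 : ℓ * (28 * (s * (γ * lam) * R)) ≤ ℓ * 1 := by nlinarith
    have h2 := le_of_mul_le_mul_left h1 (by linarith)
    have h3 : 0 ≤ s * (γ * lam) * R := by positivity
    linarith
  have hsn : 8 * s * γ ^ 2 * sw ^ 2 ≤ 1 / 2 := by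
    have h0 : 0 ≤ γ ^ 2 * sw ^ 2 := by positivity
    have h1 : 28 * (γ ^ 2 * sw ^ 2 * (4 / 3 * ℓ)) ≤ R ^ 2 := by
      refine le_trans ?_ c6
      gcongr
      have : (0 : ℝ) ≤ (K + 1) * d := by positivity
      linarith
    have h2 : R ^ 2 * (8 * s * γ ^ 2 * sw ^ 2) ≤ R ^ 2 * (1 / 2) := by
      calc _ = 8 * (s * R ^ 2) * (γ ^ 2 * sw ^ 2) := by ring
        _ = 16 * (γ ^ 2 * sw ^ 2 * ℓ) := by rw [hsR]; ring
        _ ≤ _ := by nlinarith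
    exact le_of_mul_le_mul_left h2 (by positivity)
  have ho := lintegral_exp_oracleIncr_le hL hR hlam hγ hα hα' hs hγlam hslam hmin hsmooth hG
    horacle hx
  have hn := lintegral_exp_noiseIncr_le hsw hs hsn hx
  have hmo : Measurable fun ξ => ENNReal.ofReal
      (Real.exp (s * oracleIncr f G xstar γ lam x ξ)) := by
    have := (measurable_oracleIncr (f := f) (xstar := xstar) (γ := γ) (lam := lam) hG).comp
      (measurable_prodMk_left (x := x))
    exact ((this.const_mul s).exp).ennreal_ofReal
  have hmn : Measurable fun w => ENNReal.ofReal (Real.exp (s * noiseIncr xstar γ x w)) := by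
    have := (measurable_noiseIncr (xstar := xstar) (γ := γ)).comp
      (measurable_prodMk_left (x := x))
    exact ((this.const_mul s).exp).ennreal_ofReal
  have : IsProbabilityMeasure (gaussianNoise d sw) := by unfold gaussianNoise; infer_instance
  simp only [mul_add, Real.exp_add, ENNReal.ofReal_mul (Real.exp_pos _).le]
  -- Sample and privacy noise are independent, so the two exponential moments multiply.
  rw [lintegral_prod_mul hmo.aemeasurable hmn.aemeasurable]
  refine (mul_le_mul' ho hn).trans ?_
  rw [← ENNReal.ofReal_mul (Real.exp_pos _).le, ← Real.exp_add]
  refine ENNReal.ofReal_le_ofReal (Real.exp_le_exp.2 ?_)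
  rw [le_div_iff₀ hN]
  -- Budget for the exponent: bias `3 / 14`, three quadratic terms of `1 / 100` each, and mean
  -- squared noise `4 / 7`; the total stays below `1`.
  have b1 : s * (3 * γ * R * B) * (K + 1) ≤ 3 / 14 * ℓ := by
    have : s * R * (28 * (γ * (K + 1) * B)) ≤ s * R * R := by gcongr
    nlinarith
  have b2 : s * (4 * γ ^ 2 * V) * (K + 1) ≤ ℓ / 100 := by
    have h0 : γ ^ 2 * (K + 1) * V * 2 ≤ γ ^ 2 * (K + 1) * V * ℓ := by gcongr
    have : s * (10584 * (γ ^ 2 * (K + 1) * V * 2)) ≤ s * R ^ 2 := by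
      gcongr
      linarith
    nlinarith
  have b3 : 16 * s ^ 2 * γ ^ 2 * R ^ 2 * V * (K + 1) ≤ ℓ / 100 := by
    have : s * (10584 * (γ ^ 2 * (K + 1) * ℓ * V)) ≤ s * R ^ 2 := by gcongr
    have e : 16 * s ^ 2 * γ ^ 2 * R ^ 2 * V * (K + 1) =
        32 * (s * (γ ^ 2 * (K + 1) * ℓ * V)) := by
      linear_combination 16 * s * γ ^ 2 * V * (K + 1) * hsR
    rw [e]
    linarith
  have b4 : 8 * s ^ 2 * R ^ 2 * (γ ^ 2 * sw ^ 2 * d) * (K + 1) ≤ ℓ / 100 := by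
    have : s * (12544 * (γ ^ 2 * sw ^ 2 * d * (K + 1) * ℓ)) ≤ s * R ^ 2 := by gcongr
    have e : 8 * s ^ 2 * R ^ 2 * (γ ^ 2 * sw ^ 2 * d) * (K + 1) =
        16 * (s * (γ ^ 2 * sw ^ 2 * d * (K + 1) * ℓ)) := by
      linear_combination 8 * s * (γ ^ 2 * sw ^ 2 * d) * (K + 1) * hsR
    rw [e]
    linarith
  have b5 : 8 * s * (γ ^ 2 * sw ^ 2 * d) * (K + 1) ≤ 4 / 7 * ℓ := by
    have h0 : 28 * (γ ^ 2 * sw ^ 2 * ((K + 1) * d + 0)) ≤ R ^ 2 := by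
      refine le_trans ?_ c6
      gcongr
      linarith
    have : s * (28 * (γ ^ 2 * sw ^ 2 * ((K + 1) * d + 0))) ≤ s * R ^ 2 := by gcongr
    linarith
  linarith

end OneStep

/-! ### The stopped method and the concentration of its noise -/

section Frozen

variable {d : ℕ} {S : Type*}

open Classical in
/-- A step of the method that does not move outside of the closed ball of radius `√2 R`. -/
noncomputable def frozenStep (G : E d → S → E d) (xstar : E d) (R γ lam : ℝ) (x : E d)
    (z : S × E d) : E d :=
  if x ∈ Metric.closedBall xstar (√2 * R) then x - γ • (clip (G x z.1) lam + z.2) else x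

open Classical in
/-- The noise part of the growth of the squared distance in a frozen step. -/
noncomputable def frozenIncr (f : E d → ℝ) (G : E d → S → E d) (xstar : E d) (R γ lam : ℝ)
    (x : E d) (z : S × E d) : ℝ :=
  if x ∈ Metric.closedBall xstar (√2 * R) then
    oracleIncr f G xstar γ lam x z.1 + noiseIncr xstar γ x z.2 else 0

/-- The method, stopped when it leaves the closed ball of radius `√2 R`. -/
noncomputable def frozenIterate (G : E d → S → E d) (xstar x0 : E d) (R γ lam : ℝ)
    (z : ℕ → S × E d) : ℕ → E d
  | 0 => x0
  | k + 1 => frozenStep G xstar R γ lam (frozenIterate G xstar x0 R γ lam z k) (z k)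

variable {f : E d → ℝ} {G : E d → S → E d} {xstar x0 : E d} {L R γ lam : ℝ}

lemma frozenStep_of_mem {x : E d} (hx : x ∈ Metric.closedBall xstar (√2 * R)) (z : S × E d) :
    frozenStep G xstar R γ lam x z = x - γ • (clip (G x z.1) lam + z.2) := if_pos hx

lemma frozenStep_of_notMem {x : E d} (hx : x ∉ Metric.closedBall xstar (√2 * R)) (z : S × E d) :
    frozenStep G xstar R γ lam x z = x := if_neg hx

lemma frozenIncr_of_mem {x : E d} (hx : x ∈ Metric.closedBall xstar (√2 * R)) (z : S × E d) :
    frozenIncr f G xstar R γ lam x z =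
      oracleIncr f G xstar γ lam x z.1 + noiseIncr xstar γ x z.2 := if_pos hx

lemma frozenIncr_of_notMem {x : E d} (hx : x ∉ Metric.closedBall xstar (√2 * R)) (z : S × E d) :
    frozenIncr f G xstar R γ lam x z = 0 := if_neg hx

/-- Leaving the ball is irreversible for the stopped method, so checking the last iterate suffices.
-/
lemma frozenIterate_mem_of_le {z : ℕ → S × E d} {n : ℕ}
    (h : frozenIterate G xstar x0 R γ lam z n ∈ Metric.closedBall xstar (√2 * R)) {k : ℕ}
    (hk : k ≤ n) : frozenIterate G xstar x0 R γ lam z k ∈ Metric.closedBall xstar (√2 * R) := by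
  induction n, hk using Nat.le_induction with
  | base => exact h
  | succ n _ ih =>
    refine ih ?_
    by_contra hc
    rw [frozenIterate, frozenStep_of_notMem hc] at h
    exact hc h

lemma frozenIterate_eq_iterate {z : ℕ → S × E d} {n : ℕ}
    (h : ∀ k < n, frozenIterate G xstar x0 R γ lam z k ∈ Metric.closedBall xstar (√2 * R)) :
    frozenIterate G xstar x0 R γ lam z n =
      iterate G x0 γ lam (fun j => (z j).1) (fun j => (z j).2) n := by
  induction n with
  | zero => rfl
  | succ n ih =>
    rw [frozenIterate, frozenStep_of_mem (h n n.lt_succ_self), ih fun k hk => h k (by omega),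
      iterate]

/-- Dropping the damped gap makes the recursion valid after exit too, where both sides are frozen.
It needs no membership assumption and so can be used to prove membership. -/
lemma sq_norm_frozenIterate_le (hL : 0 < L) (hR : 0 ≤ R) (hlam : 0 < lam) (hγ : 0 < γ)
    (hγL : γ ≤ 1 / (8 * L)) (hmin : ∀ y, f xstar ≤ f y)
    (hsmooth : SmoothOnSet f L (Metric.closedBall xstar (2 * R)))
    (hconv : GradConvexOn f (Metric.closedBall xstar (2 * R))) (z : ℕ → S × E d) (n : ℕ) :
    ‖frozenIterate G xstar x0 R γ lam z n - xstar‖ ^ 2 ≤ ‖x0 - xstar‖ ^ 2 +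
      ∑ j ∈ Finset.range n,
        frozenIncr f G xstar R γ lam (frozenIterate G xstar x0 R γ lam z j) (z j) := by
  induction n with
  | zero => simp [frozenIterate]
  | succ n ih =>
    rw [Finset.sum_range_succ, frozenIterate]
    set y := frozenIterate G xstar x0 R γ lam z n
    by_cases hy : y ∈ Metric.closedBall xstar (√2 * R)
    · rw [frozenStep_of_mem hy, frozenIncr_of_mem hy]
      have h1 := sq_norm_step_le hL hR hlam hγ hγL hmin hsmooth hconv hy
        (clip (G y (z n).1) lam) (z n).2
      have h2 := mul_nonneg hγ.le (dampedGap_nonneg hmin hlam y)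
      rw [oracleIncr, noiseIncr]
      linarith
    · rw [frozenStep_of_notMem hy, frozenIncr_of_notMem hy]
      linarith

lemma sum_dampedGap_le (hL : 0 < L) (hR : 0 ≤ R) (hlam : 0 < lam) (hγ : 0 < γ)
    (hγL : γ ≤ 1 / (8 * L)) (hmin : ∀ y, f xstar ≤ f y)
    (hsmooth : SmoothOnSet f L (Metric.closedBall xstar (2 * R)))
    (hconv : GradConvexOn f (Metric.closedBall xstar (2 * R))) (z : ℕ → S × E d) (n : ℕ)
    (h : ∀ k < n, frozenIterate G xstar x0 R γ lam z k ∈ Metric.closedBall xstar (√2 * R)) :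
    γ * ∑ j ∈ Finset.range n, dampedGap f xstar lam (frozenIterate G xstar x0 R γ lam z j) +
      ‖frozenIterate G xstar x0 R γ lam z n - xstar‖ ^ 2 ≤ ‖x0 - xstar‖ ^ 2 +
      ∑ j ∈ Finset.range n,
        frozenIncr f G xstar R γ lam (frozenIterate G xstar x0 R γ lam z j) (z j) := by
  induction n with
  | zero => simp [frozenIterate]
  | succ n ih =>
    have ih := ih fun k hk => h k (by omega)
    have hy := h n n.lt_succ_self
    rw [Finset.sum_range_succ, Finset.sum_range_succ, frozenIterate, frozenStep_of_mem hy,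
      frozenIncr_of_mem hy]
    have h1 := sq_norm_step_le hL hR hlam hγ hγL hmin hsmooth hconv hy
      (clip (G (frozenIterate G xstar x0 R γ lam z n) (z n).1) lam) (z n).2
    rw [oracleIncr, noiseIncr]
    linarith

/-- The deterministic part of the analysis: if the accumulated noise is small, then the iterates
stay in the ball and one of them has a small functional gap. -/
lemma convergence_of_sum_frozenIncr_le (hL : 0 < L) (hR : 0 ≤ R) (hlam : 0 < lam) (hγ : 0 < γ)
    (hγL : γ ≤ 1 / (8 * L)) (hmin : ∀ y, f xstar ≤ f y) (hx0 : ‖x0 - xstar‖ ≤ R)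
    (hsmooth : SmoothOnSet f L (Metric.closedBall xstar (2 * R)))
    (hconv : GradConvexOn f (Metric.closedBall xstar (2 * R))) (z : ℕ → S × E d) (K : ℕ)
    (h : ∑ j ∈ Finset.range (K + 1),
      frozenIncr f G xstar R γ lam (frozenIterate G xstar x0 R γ lam z j) (z j) ≤ R ^ 2) :
    (∃ k ≤ K, f (iterate G x0 γ lam (fun j => (z j).1) (fun j => (z j).2) k) - f xstar
        ≤ 4 * R ^ 2 / (γ * (K + 1)) + 64 * L * R ^ 4 / (lam ^ 2 * γ ^ 2 * ((K : ℝ) + 1) ^ 2)) ∧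
      ∀ k ≤ K, iterate G x0 γ lam (fun j => (z j).1) (fun j => (z j).2) k ∈
        Metric.closedBall xstar (√2 * R) := by
  have hx02 : ‖x0 - xstar‖ ^ 2 ≤ R ^ 2 := pow_le_pow_left₀ (norm_nonneg _) hx0 2
  -- The radius `√2 * R` arises here: `R ^ 2` from the start plus `R ^ 2` from the accumulated
  -- noise.
  have hend : frozenIterate G xstar x0 R γ lam z (K + 1) ∈ Metric.closedBall xstar (√2 * R) :=
    mem_closedBall_of_sq_norm_sub_le hR
      ((sq_norm_frozenIterate_le hL hR hlam hγ hγL hmin hsmooth hconv z (K + 1)).trans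
        (by linarith))
  have hmem : ∀ k ≤ K, frozenIterate G xstar x0 R γ lam z k ∈ Metric.closedBall xstar (√2 * R) :=
    fun k hk => frozenIterate_mem_of_le hend (by omega)
  have heq : ∀ k ≤ K, frozenIterate G xstar x0 R γ lam z k =
      iterate G x0 γ lam (fun j => (z j).1) (fun j => (z j).2) k :=
    fun k hk => frozenIterate_eq_iterate fun j hj => hmem j (by omega)
  refine ⟨?_, fun k hk => heq k hk ▸ hmem k hk⟩
  have hsum := sum_dampedGap_le hL hR hlam hγ hγL hmin hsmooth hconv z (K + 1)
    fun k hk => hmem k (by omega)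
  have hN : (0 : ℝ) < K + 1 := by positivity
  obtain ⟨k, hk, hkq⟩ : ∃ k ∈ Finset.range (K + 1),
      dampedGap f xstar lam (frozenIterate G xstar x0 R γ lam z k) ≤
        2 * R ^ 2 / (γ * (K + 1)) := by
    refine Finset.exists_le_of_sum_le Finset.nonempty_range_add_one ?_
    rw [Finset.sum_const, Finset.card_range, nsmul_eq_mul, Nat.cast_add_one]
    have : ((K : ℝ) + 1) * (2 * R ^ 2 / (γ * (K + 1))) = 2 * R ^ 2 / γ := by field_simp
    rw [this, le_div_iff₀ hγ]
    have := sq_nonneg ‖frozenIterate G xstar x0 R γ lam z (K + 1) - xstar‖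
    linarith
  have hkK : k ≤ K := Nat.lt_succ_iff.1 (Finset.mem_range.1 hk)
  refine ⟨k, hkK, ?_⟩
  rw [← heq k hkK]
  refine (sub_le_of_dampedGap_le hL hR hlam hmin hsmooth hconv (hmem k hkK) (by positivity)
    hkq).trans (add_le_add ?_ (le_of_eq ?_))
  · gcongr
    norm_num
  · field_simp
    ring

variable [MeasurableSpace S]

lemma measurable_frozenStep (hG : Measurable (Function.uncurry G)) :
    Measurable (Function.uncurry (frozenStep G xstar R γ lam)) := by
  have h1 : Measurable fun p : E d × S × E d => G p.1 p.2.1 :=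
    hG.comp (f := fun p : E d × S × E d => (p.1, p.2.1)) (by fun_prop)
  have h2 := measurable_clip h1 lam
  exact Measurable.ite (measurable_fst Metric.isClosed_closedBall.measurableSet)
    (by fun_prop) measurable_fst

lemma measurable_frozenIncr (hG : Measurable (Function.uncurry G)) :
    Measurable (Function.uncurry (frozenIncr f G xstar R γ lam)) := by
  have h1 : Measurable fun p : E d × S × E d => oracleIncr f G xstar γ lam p.1 p.2.1 :=
    (measurable_oracleIncr hG).comp (f := fun p : E d × S × E d => (p.1, p.2.1)) (by fun_prop)
  have h2 : Measurable fun p : E d × S × E d => noiseIncr xstar γ p.1 p.2.2 :=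
    measurable_noiseIncr.comp (f := fun p : E d × S × E d => (p.1, p.2.2)) (by fun_prop)
  exact Measurable.ite (measurable_fst Metric.isClosed_closedBall.measurableSet)
    (h1.add h2) measurable_const

/-- Exponential moment of the accumulated noise of the stopped method. -/
lemma lintegral_exp_sum_frozenIncr_le {Ω : Type*} [MeasurableSpace Ω] {P : Measure Ω}
    [IsProbabilityMeasure P] {μ : Measure (S × E d)} [IsProbabilityMeasure μ] {s c : ℝ}
    (hc : 0 ≤ c) (hG : Measurable (Function.uncurry G))
    (hone : ∀ x ∈ Metric.closedBall xstar (√2 * R), ∫⁻ z, ENNReal.ofReal (Real.exp (s *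
      (oracleIncr f G xstar γ lam x z.1 + noiseIncr xstar γ x z.2))) ∂μ ≤
        ENNReal.ofReal (Real.exp c))
    {u : ℕ → Ω → S × E d} (hu : ∀ k, Measurable (u k))
    (hlaw : ∀ k, P.map (u k) = μ) (hind : iIndepFun u P) (n : ℕ) :
    ∫⁻ a, ENNReal.ofReal (Real.exp (s * ∑ j ∈ Finset.range n, frozenIncr f G xstar R γ lam
      (frozenIterate G xstar x0 R γ lam (fun j => u j a) j) (u j a))) ∂P ≤
        ENNReal.ofReal (Real.exp (n * c)) := by
  have hF : Measurable (Function.uncurry fun (x : E d) (z : S × E d) =>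
      ENNReal.ofReal (Real.exp (s * frozenIncr f G xstar R γ lam x z))) :=
    ((measurable_frozenIncr hG).const_mul s).exp.ennreal_ofReal
  have hC : ∀ x : E d, ∫⁻ z, ENNReal.ofReal (Real.exp (s * frozenIncr f G xstar R γ lam x z)) ∂μ ≤
      ENNReal.ofReal (Real.exp c) := fun x => by
    -- Outside the ball the increment vanishes and its exponential moment is `1`; this is where `0 ≤
    -- c` enters.
    by_cases hx : x ∈ Metric.closedBall xstar (√2 * R)
    · simpa only [frozenIncr_of_mem hx] using hone x hx
    · simp only [frozenIncr_of_notMem hx, mul_zero, Real.exp_zero, ENNReal.ofReal_one,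
        lintegral_const, measure_univ, mul_one]
      exact ENNReal.one_le_ofReal.2 (Real.one_le_exp hc)
  have hchain := lintegral_prod_chain_le hu hind hlaw
    (measurable_frozenStep (xstar := xstar) (R := R) (γ := γ) (lam := lam) hG)
    (Y := fun k a => frozenIterate G xstar x0 R γ lam (fun j => u j a) k) (fun _ => rfl)
    (fun _ _ => rfl) hF hC n
  rw [← ENNReal.ofReal_pow (Real.exp_pos _).le, ← Real.exp_nat_mul] at hchain
  refine le_trans (le_of_eq (lintegral_congr fun a => ?_)) hchain
  rw [← ENNReal.ofReal_prod_of_nonneg fun _ _ => (Real.exp_pos _).le, ← Real.exp_sum,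
    Finset.mul_sum]

/-- Chernoff bound for a real random variable. -/
lemma measure_ge_le_of_lintegral_exp_le {Ω : Type*} [MeasurableSpace Ω] {P : Measure Ω} {T : Ω → ℝ}
    (hT : Measurable T) {s b r : ℝ} (hs : 0 ≤ s)
    (h : ∫⁻ a, ENNReal.ofReal (Real.exp (s * T a)) ∂P ≤ ENNReal.ofReal (Real.exp b)) :
    P {a | r ≤ T a} ≤ ENNReal.ofReal (Real.exp (b - s * r)) := by
  have hsub : {a | r ≤ T a} ⊆
      {a | ENNReal.ofReal (Real.exp (s * r)) ≤ ENNReal.ofReal (Real.exp (s * T a))} := fun a ha =>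
    ENNReal.ofReal_le_ofReal (Real.exp_le_exp.2 (mul_le_mul_of_nonneg_left ha hs))
  refine (measure_mono hsub).trans ?_
  refine (meas_ge_le_lintegral_div (by fun_prop) (by simp [Real.exp_pos])
    ENNReal.ofReal_ne_top).trans ?_
  refine (ENNReal.div_le_div_right h _).trans ?_
  rw [← ENNReal.ofReal_div_of_pos (Real.exp_pos _), ← Real.exp_sub]

/-- With high probability the accumulated noise of the stopped method is small. -/
lemma measure_sum_frozenIncr_ge_le {Ω : Type*} [MeasurableSpace Ω] {P : Measure Ω}
    [IsProbabilityMeasure P] {D : Measure S} [IsProbabilityMeasure D] {σ α sw β : ℝ} {K : ℕ}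
    (hL : 0 < L) (hR : 0 ≤ R) (hlam : 0 < lam) (hγ : 0 < γ)
    (hσ : 0 < σ) (hα : 1 < α) (hα' : α ≤ 2) (hsw : 0 ≤ sw) (hβ : 0 < β) (hβ' : β ≤ 1)
    (hstep : StepSizeCond d γ L R lam σ α sw β K) (hmin : ∀ y, f xstar ≤ f y)
    (hsmooth : SmoothOnSet f L (Metric.closedBall xstar (2 * R)))
    (hG : Measurable (Function.uncurry G))
    (horacle : OracleOn f G D σ α (Metric.closedBall xstar (2 * R)))
    {u : ℕ → Ω → S × E d} (hu : ∀ k, Measurable (u k))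
    (hlaw : ∀ k, P.map (u k) = D.prod (gaussianNoise d sw)) (hind : iIndepFun u P) :
    P {a | R ^ 2 ≤ ∑ j ∈ Finset.range (K + 1), frozenIncr f G xstar R γ lam
      (frozenIterate G xstar x0 R γ lam (fun j => u j a) j) (u j a)} ≤ ENNReal.ofReal β := by
  have hR0 := hstep.pos_radius hγ hR
  have hl := two_le_log (K := K) hβ hβ'
  have hone : ∀ x : E d, x ∈ Metric.closedBall xstar (√2 * R) → _ := fun x hx =>
    lintegral_exp_incr_le hL hR hlam hγ hσ hα hα' hsw hβ hβ' hstep hmin hsmooth hG horacle hx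
  have : IsProbabilityMeasure (gaussianNoise d sw) := by unfold gaussianNoise; infer_instance
  have hexp := lintegral_exp_sum_frozenIncr_le (x0 := x0)
    (div_nonneg (by linarith) (by positivity)) hG hone hu hlaw hind (K + 1)
  have hYm : ∀ k, Measurable fun a => frozenIterate G xstar x0 R γ lam (fun j => u j a) k :=
    measurable_of_recursion hu (measurable_frozenStep hG) (fun _ => rfl) fun _ _ => rfl
  refine (measure_ge_le_of_lintegral_exp_le (Finset.measurable_sum _ fun j _ =>
    (measurable_frozenIncr hG).comp ((hYm j).prodMk (hu j)))
    (div_nonneg (by linarith) (by positivity)) hexp).trans (ENNReal.ofReal_le_ofReal ?_)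
  have hN : (0 : ℝ) ≤ K := K.cast_nonneg
  -- The Chernoff exponent is `ℓ - 2 ℓ = -ℓ`, so the probability is at most `β / (8 (K + 1))`.
  have he : ((K + 1 : ℕ) : ℝ) * (Real.log (8 * (K + 1) / β) / (K + 1)) -
      2 * Real.log (8 * (K + 1) / β) / R ^ 2 * R ^ 2 = -Real.log (8 * (K + 1) / β) := by
    push_cast
    field_simp
    ring
  rw [he, Real.exp_neg, Real.exp_log (by positivity), inv_div, div_le_iff₀ (by positivity)]
  nlinarith

end Frozen

end DPClippedSGD

theorem theorem1 {d : ℕ}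
    {Ω : Type*} [MeasurableSpace Ω] (P : Measure Ω) [IsProbabilityMeasure P]
    {S : Type*} [MeasurableSpace S] (D : Measure S) [IsProbabilityMeasure D]
    -- objective, a minimizer, starting point
    (f : DPClippedSGD.E d → ℝ) (xstar x0 : DPClippedSGD.E d)
    (L R σ α lam sw β γ : ℝ) (K : ℕ)
    (hL : 0 < L) (hσ : 0 < σ) (hα : 1 < α) (hα' : α ≤ 2) (hlam : 0 < lam) (hsw : 0 ≤ sw)
    (hβ : 0 < β) (hβ' : β ≤ 1) (hγ : 0 < γ)
    (hmin : ∀ y, f xstar ≤ f y) (hR : ‖x0 - xstar‖ ≤ R)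
    (hsmooth : DPClippedSGD.SmoothOnSet f L (Metric.closedBall xstar (2 * R)))
    (hconv : DPClippedSGD.GradConvexOn f (Metric.closedBall xstar (2 * R)))
    -- stochastic gradient oracle
    (G : DPClippedSGD.E d → S → DPClippedSGD.E d) (hG : Measurable (Function.uncurry G))
    (horacle : DPClippedSGD.OracleOn f G D σ α (Metric.closedBall xstar (2 * R)))
    -- fresh samples and privacy noise: the pairs `(ξ k, w k)` are i.i.d. with law `D ⊗ N(0, sw² I)`
    (ξ : ℕ → Ω → S) (w : ℕ → Ω → DPClippedSGD.E d)
    (hξ : ∀ k, Measurable (ξ k)) (hw : ∀ k, Measurable (w k))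
    (hlaw : ∀ k, P.map (fun a => (ξ k a, w k a)) = D.prod (DPClippedSGD.gaussianNoise d sw))
    (hindep : iIndepFun (fun k a => (ξ k a, w k a)) P)
    (hstep : DPClippedSGD.StepSizeCond d γ L R lam σ α sw β K)
    (X : ℕ → Ω → DPClippedSGD.E d)
    (hX : ∀ k a, X k a =
      DPClippedSGD.iterate G x0 γ lam (fun j => ξ j a) (fun j => w j a) k) :
    P {a | (Finset.range (K + 1)).inf' Finset.nonempty_range_add_one (fun k => f (X k a)) - f xstar
          ≤ 4 * R ^ 2 / (γ * (K + 1))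
            + 64 * L * R ^ 4 / (lam ^ 2 * γ ^ 2 * ((K : ℝ) + 1) ^ 2)
        ∧ ∀ k ≤ K, X k a ∈ Metric.closedBall xstar (√2 * R)}
      ≥ ENNReal.ofReal (1 - β) := by
  have hR0 : 0 ≤ R := (norm_nonneg _).trans hR
  have hbad := DPClippedSGD.measure_sum_frozenIncr_ge_le (x0 := x0) hL hR0 hlam hγ hσ hα hα' hsw
    hβ hβ' hstep hmin hsmooth hG horacle (fun k => (hξ k).prodMk (hw k)) hlaw hindep
  rw [ge_iff_le, ENNReal.ofReal_sub _ hβ.le, ENNReal.ofReal_one]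
  refine (tsub_le_tsub_left hbad 1).trans ?_
  -- Covering the whole space by the bad and the good event needs only subadditivity, hence no
  -- measurability of the good event.
  rw [tsub_le_iff_left, ← measure_univ (μ := P)]
  refine le_trans (measure_mono fun a _ => ?_) (measure_union_le _ _)
  refine or_iff_not_imp_left.2 fun ha => ?_
  obtain ⟨⟨k, hk, hkf⟩, hball⟩ := DPClippedSGD.convergence_of_sum_frozenIncr_le (f := f) (G := G)
    hL hR0 hlam hγ hstep.le_zero hmin hR hsmooth hconv (fun j => (ξ j a, w j a)) K
    (le_of_not_ge ha)
  refine ⟨?_, fun k hk => hX k a ▸ hball k hk⟩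
  refine le_trans (sub_le_sub_right (Finset.inf'_le _ (Finset.mem_range.2
    (Nat.lt_succ_of_le hk))) _) ?_
  simpa only [hX] using hkf
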